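/- Let $\Gamma=\mathbb{Z}\omega_1\oplus\mathbb{Z}\omega_2\subset\mathbb{C}$ be a lattice with $\operatorname{Im}(\omega_2/\omega_1)>0$, put $A=\frac1\pi\operatorname{Im}(\omega_2\overline{\omega_1})$ and $\langle z,w\rangle=\exp\big((z\overline w-w\overline z)/A\big)$, and let $\delta(u)=1$ if $u\in\Gamma$ and $\delta(u)=0$ otherwise. For an integer $n\ge 0$ and $z_0,w_0\in\mathbb{C}$ let $K^*_n(z_0,w_0,s)$ be the meromorphic continuation to $s\in\mathbb{C}$ of the series $$\sum_{\gamma\in\Gamma,\ \gamma\ne -z_0}\frac{(\overline{z_0}+\overline{\gamma})^n}{|z_0+\gamma|^{2s}}\,\langle\gamma,w_0\rangle\qquad(\operatorname{Re}s>n/2+1).$$ For integers $a\ge 0$, $b>0$ the Eisenstein–Kronecker number is $e^*_{a,b}(z_0,w_0)=K^*_{a+b}(z_0,w_0,b)$. Let $\sigma(z)=z\prod_{\gamma\in\Gamma\setminus\{0\}}(1-\frac z\gamma)\exp\big(\frac z\gamma+\frac{z^2}{2\gamma^2}\big)$, let $\theta(z)=\exp\big(-\tfrac12 e^*_{0,2}(0,0)z^2\big)\sigma(z)$,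 and let $$\Theta(z,w)=\frac{\theta(z+w)}{\theta(z)\theta(w)},\qquad \Theta_{z_0,w_0}(z,w)=\exp\Big(-\frac{z_0\overline{w_0}}{A}\Big)\exp\Big(-\frac{z\overline{w_0}+w\overline{z_0}}{A}\Big)\Theta(z+z_0,w+w_0)$$ be the Kronecker theta function and its translate. **Theorem.** Let $z_0,w_0\in\mathbb{C}$. For every $n\ge1$ the continuation $K^*_n(z_0,w_0,s)$ exists and is entire in $s$, so all the numbers $e^*_{a,b}(z_0,w_0)$ with $a\ge0$, $b>0$ are defined, and the Laurent expansion of $\Theta_{z_0,w_0}$ at $(0,0)$ is $$\Theta_{z_0,w_0}(z,w)=\langle w_0,z_0\rangle\frac{\delta(z_0)}{z}+\frac{\delta(w_0)}{w}+\sum_{a\ge0,\ b>0}(-1)^{a+b-1}\frac{e^*_{a,b}(z_0,w_0)}{a!\,A^a}\,z^{b-1}w^a .$$ That is, there is $r>0$ such that for all $z,w$ with $|z|<r$, $|w|<r$, with $z\neq0$ if $z_0\in\Gamma$ and $w\ne0$ if $w_0\in\Gamma$, neither $z+z_0$ nor $w+w_0$ lies in $\Gamma$, the double series converges absolutely, and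 the identity holds (a term $\delta(\cdot)/z$ or $\delta(\cdot)/w$ with $\delta(\cdot)=0$ being read as $0$). Thus $\Theta_{z_0,w_0}$ is the two-variable generating function of the Eisenstein–Kronecker numbers. -/

import Mathlib

open scoped ComplexConjugate Nat

noncomputable section

namespace EisensteinKronecker

/-- `A(Γ) = Im(ω₂ * conj ω₁) / π` for the lattice `Γ = ℤω₁ ⊕ ℤω₂`
(positive when `Im(ω₂ / ω₁) > 0`). -/
def areaConst (L : PeriodPair) : ℝ := (L.ω₂ * conj L.ω₁).im / Real.pi

/-- The pairing `⟨z, w⟩ = exp((z * conj w - w * conj z) / A)`. -/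
def pairing (L : PeriodPair) (z w : ℂ) : ℂ :=
  Complex.exp ((z * conj w - w * conj z) / (areaConst L : ℂ))

open Classical in
/-- `δ(u) = 1` if `u ∈ Γ`, and `δ(u) = 0` otherwise. -/
def latticeDelta (L : PeriodPair) (u : ℂ) : ℂ := if u ∈ L.lattice then 1 else 0

/-- The series `∑* conj(z₀ + γ) ^ a / |z₀ + γ| ^ (2s) * ⟨γ, w₀⟩` over all `γ ∈ Γ` with
`γ ≠ -z₀`; it converges absolutely for `Re s > a / 2 + 1`. -/
def lerchSeries (L : PeriodPair) (a : ℕ) (z₀ w₀ s : ℂ) : ℂ :=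
  ∑' γ : {γ : L.lattice // (γ : ℂ) ≠ -z₀},
    conj (z₀ + (γ.1 : ℂ)) ^ a / (‖z₀ + (γ.1 : ℂ)‖ : ℂ) ^ (2 * s) * pairing L (γ.1 : ℂ) w₀

/-- `F` is the meromorphic continuation to the whole `s`-plane of the series above. The normal form
condition only normalises the values: `F` is continuous wherever its singularity is
removable, and takes the value `0` at its poles. -/
structure IsLerchContinuation (L : PeriodPair) (a : ℕ) (z₀ w₀ : ℂ) (F : ℂ → ℂ) : Prop where
  meromorphic : MeromorphicNFOn F Set.univ
  eq_series : ∀ s : ℂ, (a : ℝ) / 2 + 1 < s.re → F s = lerchSeries L a z₀ w₀ s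

/-- The meromorphic continuation is unique. -/
theorem IsLerchContinuation.unique {L : PeriodPair} {a : ℕ} {z₀ w₀ : ℂ} {F G : ℂ → ℂ}
    (hF : IsLerchContinuation L a z₀ w₀ F) (hG : IsLerchContinuation L a z₀ w₀ G) : F = G := by
  have hm : MeromorphicOn (F - G) Set.univ := fun x hx =>
    (hF.meromorphic hx).meromorphicAt.sub (hG.meromorphic hx).meromorphicAt
  set p : ℂ := (((a : ℝ) / 2 + 2 : ℝ) : ℂ) with hp
  have hopen : IsOpen {s : ℂ | (a : ℝ) / 2 + 1 < s.re} :=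
    isOpen_lt continuous_const Complex.continuous_re
  have hmem : p ∈ {s : ℂ | (a : ℝ) / 2 + 1 < s.re} := by
    simp only [hp, Set.mem_setOf_eq, Complex.ofReal_re]; linarith
  have htop : meromorphicOrderAt (F - G) p = ⊤ := by
    rw [meromorphicOrderAt_eq_top_iff]
    refine Filter.Eventually.filter_mono nhdsWithin_le_nhds ?_
    filter_upwards [hopen.mem_nhds hmem] with s hs
    simp [hF.eq_series s hs, hG.eq_series s hs]
  funext x
  have hx : meromorphicOrderAt (F - G) x = ⊤ := by
    by_contra h
    exact hm.meromorphicOrderAt_ne_top_of_isPreconnected isPreconnected_univ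
      (Set.mem_univ x) (Set.mem_univ p) h htop
  rw [meromorphicOrderAt_eq_top_iff] at hx
  have hE : F =ᶠ[nhdsWithin x {x}ᶜ] G := by
    filter_upwards [hx] with s hs
    exact sub_eq_zero.mp hs
  exact (((hF.meromorphic (Set.mem_univ x)).eventuallyEq_nhdsNE_iff_eventuallyEq_nhds
    (hG.meromorphic (Set.mem_univ x))).mp hE).eq_of_nhds

open Classical in
/-- The Eisenstein–Kronecker–Lerch function `K*_a(z₀, w₀, s)`: the (unique) meromorphic
continuation of its defining series. -/
def lerchK (L : PeriodPair) (a : ℕ) (z₀ w₀ : ℂ) : ℂ → ℂ :=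
  if h : ∃ F, IsLerchContinuation L a z₀ w₀ F then h.choose else 0

/-- The Eisenstein–Kronecker number `e*_{a,b}(z₀, w₀) = K*_{a+b}(z₀, w₀, b)`, used for `b > 0`. -/
def ekNumber (L : PeriodPair) (a b : ℕ) (z₀ w₀ : ℂ) : ℂ := lerchK L (a + b) z₀ w₀ (b : ℂ)

/-- The Weierstrass `σ`-function of the lattice. -/
def sigma (L : PeriodPair) (z : ℂ) : ℂ :=
  z * ∏' γ : {γ : L.lattice // γ ≠ 0},
    (1 - z / (γ.1 : ℂ)) * Complex.exp (z / (γ.1 : ℂ) + z ^ 2 / (2 * (γ.1 : ℂ) ^ 2))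

/-- The reduced theta function `θ(z) = exp(-e*_{0,2}(0,0) z² / 2) σ(z)` of the divisor `[0]`. -/
def theta (L : PeriodPair) (z : ℂ) : ℂ :=
  Complex.exp (-(ekNumber L 0 2 0 0 / 2) * z ^ 2) * sigma L z

/-- The Kronecker theta function `Θ(z, w) = θ(z + w) / (θ(z) θ(w))`, a function away from
its poles `z ∈ Γ` and `w ∈ Γ`. -/
def kroneckerTheta (L : PeriodPair) (z w : ℂ) : ℂ :=
  theta L (z + w) / (theta L z * theta L w)

/-- The translate `Θ_{z₀, w₀}(z, w)` of the Kronecker theta function. -/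
def kroneckerThetaTranslate (L : PeriodPair) (z₀ w₀ z w : ℂ) : ℂ :=
  Complex.exp (-(z₀ * conj w₀) / (areaConst L : ℂ)) *
    Complex.exp (-(z * conj w₀ + w * conj z₀) / (areaConst L : ℂ)) *
      kroneckerTheta L (z + z₀) (w + w₀)

end EisensteinKronecker

end

open scoped ComplexConjugate Nat
open Complex Filter Topology Asymptotics Set MeasureTheory

namespace EisensteinKronecker

/-! ### Gaussian sums over a lattice -/

/-! Everything reduces to one Gaussian-damped lattice sum, seen from two sides.

On the arithmetic side, Poisson summation (`gaussSum_eq`) gives the theta series of `conj x ^ n *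
exp(-t|x|²/A) * ⟨γ, w₀⟩`, with `x = z₀ + γ`, a functional equation under `t ↦ 1/t` that exchanges
`z₀` and `w₀`. For `n ≥ 1` it has no constant term, so its Mellin transform is entire, and division
by `Γ(s) A ^ s` yields the continuation. At `s = b`, cutting at `t = 1` and folding `(0, 1)` onto
`(1, ∞)` writes `e*_{a,b}` as two integrals over `(1, ∞)` (`ekNumber_eq`). Summed against `z ^ (b-1)
w ^ a`, the integrands become exponentials in `t`, and each `x ≠ 0` contributes a damped multiple of
`1 / (x + z)` (`hasSum_ekNumber`). The missing points `x = 0` are exactly the polar terms; once they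
are restored, the two sums form a `kroneckerSeries` (`tsum_genClosed_add`).

On the analytic side, that series carries a free parameter `μ`, on which it does not depend because
Poisson summation is self-dual at `t = 1` (`kroneckerSeries_eq`). Specialising `μ` gives its
quasi-periodicity. For fixed `w ∉ Γ`, the series and `Θ(z, w)` have the same multipliers `exp(w conj
l / A)` and a simple pole of residue 1 at `z = 0`, so Liouville's theorem makes them equal
(`kroneckerTheta_eq_kroneckerSeries`).

The multipliers of `Θ` come from those of `θ`, hence from `θ'/θ`. This is identified with the
constant term `dampedZeta` of the series at `W = 0` by comparing Laurent coefficients: the case `z₀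
= w₀ = w = 0` of the generating function gives the numbers `e*_{0,b}`, which are `0` for `b = 1`,
the constant in the Gaussian factor of `θ` for `b = 2`, and the Eisenstein sums found in `σ'/σ` for
`b ≥ 3` (`eventually_deriv_theta`). -/

theorem areaConst_pos {L : PeriodPair} (hL : 0 < (L.ω₂ / L.ω₁).im) : 0 < areaConst L := by
  have h0 : L.ω₁ ≠ 0 := by
    rintro h
    simp [h] at hL
  have h1 : (L.ω₂ * conj L.ω₁).im = (L.ω₂ / L.ω₁).im * normSq L.ω₁ := by
    have : L.ω₂ * conj L.ω₁ = L.ω₂ / L.ω₁ * (normSq L.ω₁ : ℂ) := by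
      rw [normSq_eq_conj_mul_self]
      field_simp
    rw [this, im_mul_ofReal]
  rw [areaConst, h1]
  exact div_pos (mul_pos hL (normSq_pos.2 h0)) Real.pi_pos

/-- Completing the square absorbs the linear term and leaves a multiple of `exp(-|γ|)`, which is at
most `6 |γ|⁻³`; the exponent 3 exceeds the real rank 2 of the lattice. -/
theorem summable_exp_neg_sq (L : PeriodPair) {c : ℝ} (hc : 0 < c) (d : ℝ) :
    Summable fun γ : L.lattice => Real.exp (-c * ‖(γ : ℂ)‖ ^ 2 + d * ‖(γ : ℂ)‖) := by
  have h3 : Summable fun γ : L.lattice => ‖γ‖⁻¹ ^ 3 :=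
    ZLattice.summable_norm_pow_inv L.lattice 3 (by simp)
  have h3' := h3.mul_left (Real.exp ((d + 1) ^ 2 / (4 * c)) * 6)
  refine Summable.of_norm_bounded_eventually h3' ?_
  have hev : ∀ᶠ γ : L.lattice in cofinite, γ ≠ 0 := by
    simp
  filter_upwards [hev] with γ hγ
  have hx : 0 < ‖γ‖ := norm_pos_iff.2 hγ
  have hx' : ‖(γ : ℂ)‖ = ‖γ‖ := rfl
  rw [hx', Real.norm_of_nonneg (Real.exp_pos _).le]
  set x := ‖γ‖
  have h1 : -c * x ^ 2 + d * x ≤ (d + 1) ^ 2 / (4 * c) + -x := by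
    have : (d + 1) ^ 2 / (4 * c) + -x - (-c * x ^ 2 + d * x) = (2 * c * x - (d + 1)) ^ 2 / (4 * c) := by
      field_simp
      ring
    have h2 : 0 ≤ (2 * c * x - (d + 1)) ^ 2 / (4 * c) := by positivity
    linarith
  have h2 : Real.exp (-x) ≤ 6 * x⁻¹ ^ 3 := by
    have := Real.pow_div_factorial_le_exp x hx.le 3
    rw [Real.exp_neg, inv_pow, ← div_eq_mul_inv, inv_eq_one_div,
      div_le_div_iff₀ (Real.exp_pos _) (by positivity)]
    simp [Nat.factorial] at this
    linarith
  calc Real.exp (-c * x ^ 2 + d * x) ≤ Real.exp ((d + 1) ^ 2 / (4 * c) + -x) := Real.exp_le_exp.2 h1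
    _ = Real.exp ((d + 1) ^ 2 / (4 * c)) * Real.exp (-x) := Real.exp_add _ _
    _ ≤ _ := by
      rw [mul_assoc]
      gcongr

/-- The sum `∑ exp((-t|γ|² + aγ + b conj γ) / A)` over the lattice. -/
noncomputable def gaussSum (L : PeriodPair) (t : ℝ) (a b : ℂ) : ℂ :=
  ∑' γ : L.lattice, cexp ((-t * ((γ : ℂ) * conj (γ : ℂ)) + a * γ + b * conj (γ : ℂ)) / areaConst L)

theorem norm_cexp_gauss_le {A t : ℝ} (hA : 0 < A) (a b γ : ℂ) :
    ‖cexp ((-t * (γ * conj γ) + a * γ + b * conj γ) / A)‖ ≤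
      Real.exp (-(t / A) * ‖γ‖ ^ 2 + ((‖a‖ + ‖b‖) / A) * ‖γ‖) := by
  rw [norm_exp]
  apply Real.exp_le_exp.2
  rw [div_ofReal_re, add_re, add_re, mul_conj, normSq_eq_norm_sq]
  have h1 : (a * γ).re ≤ ‖a‖ * ‖γ‖ := (re_le_norm _).trans (norm_mul _ _).le
  have h2 : (b * conj γ).re ≤ ‖b‖ * ‖γ‖ :=
    (re_le_norm _).trans (by rw [norm_mul, norm_conj])
  have h3 : (-(t : ℂ) * ((‖γ‖ ^ 2 : ℝ) : ℂ)).re = -t * ‖γ‖ ^ 2 := by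
    rw [← ofReal_neg, ← ofReal_mul, ofReal_re]
  rw [h3]
  calc _ ≤ (-t * ‖γ‖ ^ 2 + ‖a‖ * ‖γ‖ + ‖b‖ * ‖γ‖) / A := by gcongr
    _ = _ := by ring

theorem summable_gaussSum {L : PeriodPair} (hA : 0 < areaConst L) {t : ℝ} (ht : 0 < t) (a b : ℂ) :
    Summable fun γ : L.lattice =>
      cexp ((-t * ((γ : ℂ) * conj (γ : ℂ)) + a * γ + b * conj (γ : ℂ)) / areaConst L) :=
  Summable.of_norm_bounded (summable_exp_neg_sq L (div_pos ht hA) ((‖a‖ + ‖b‖) / areaConst L))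
    fun γ => norm_cexp_gauss_le hA a b γ

theorem summable_cexp_int_sq {c : ℝ} (hc : 0 < c) (d : ℂ) :
    Summable fun m : ℤ => cexp (-c * m ^ 2 + d * m) := by
  have him : 0 < (I * (c / Real.pi : ℝ)).im := by
    simp only [I_mul_im, ofReal_re]
    positivity
  have := (summable_jacobiTheta₂_term_iff (d / (2 * Real.pi * I)) (I * (c / Real.pi : ℝ))).2 him
  refine this.congr fun m => ?_
  rw [jacobiTheta₂_term]
  congr 1
  have : (Real.pi : ℂ) ≠ 0 := by exact_mod_cast Real.pi_ne_zero
  push_cast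
  field_simp
  rw [I_sq]
  ring

/-- One-dimensional Poisson summation for a Gaussian with a linear exponent. -/
theorem tsum_cexp_int_sq {c : ℝ} (hc : 0 < c) (d : ℂ) :
    ∑' m : ℤ, cexp (-c * m ^ 2 + d * m) =
      (Real.sqrt (Real.pi / c) : ℂ) * ∑' k : ℤ, cexp ((d + 2 * Real.pi * I * k) ^ 2 / (4 * c)) := by
  have hpi : (Real.pi : ℂ) ≠ 0 := by exact_mod_cast Real.pi_ne_zero
  have hc0 : (c : ℂ) ≠ 0 := by exact_mod_cast hc.ne'
  have h := jacobiTheta₂_functional_equation (d / (2 * Real.pi * I)) (I * (c / Real.pi : ℝ))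
  rw [jacobiTheta₂, jacobiTheta₂] at h
  have h1 : ∑' m : ℤ, cexp (-c * m ^ 2 + d * m) =
      ∑' m : ℤ, jacobiTheta₂_term m (d / (2 * Real.pi * I)) (I * (c / Real.pi : ℝ)) := by
    refine tsum_congr fun m => ?_
    rw [jacobiTheta₂_term]
    congr 1
    push_cast
    field_simp
    rw [I_sq]
    ring
  have h2 : 1 / (-I * (I * (c / Real.pi : ℝ))) ^ (1 / 2 : ℂ) = (Real.sqrt (Real.pi / c) : ℂ) := by
    have e1 : -I * (I * (c / Real.pi : ℝ)) = ((c / Real.pi : ℝ) : ℂ) := by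
      rw [← mul_assoc, neg_mul, I_mul_I]
      simp
    have e2 : ((1 / 2 : ℂ)) = ((1 / 2 : ℝ) : ℂ) := by push_cast; rfl
    rw [e1, e2, ← ofReal_cpow (by positivity), ← Real.sqrt_eq_rpow, ← ofReal_one, ← ofReal_div,
      ← inv_div c Real.pi, Real.sqrt_inv, one_div]
  rw [h1, h, h2, mul_assoc, ← tsum_mul_left,
    ← (Equiv.neg ℤ).tsum_eq fun k : ℤ => cexp ((d + 2 * Real.pi * I * k) ^ 2 / (4 * c))]
  congr 1
  refine tsum_congr fun k => ?_
  rw [jacobiTheta₂_term, ← exp_add]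
  congr 1
  simp only [Equiv.neg_apply]
  push_cast
  field_simp
  simp only [I_sq]
  ring

theorem tsum_lattice_eq {L : PeriodPair} (f : ℂ → ℂ) (hf : Summable fun γ : L.lattice => f γ) :
    ∑' γ : L.lattice, f γ = ∑' (n : ℤ) (m : ℤ), f (m * L.ω₁ + n * L.ω₂) := by
  have e := L.latticeEquivProd.symm.toEquiv
  have h1 : ∀ p : ℤ × ℤ, ((L.latticeEquivProd.symm p : L.lattice) : ℂ) = p.1 * L.ω₁ + p.2 * L.ω₂ :=
    L.latticeEquiv_symm_apply
  have h2 := (L.latticeEquivProd.symm.toEquiv.trans (Equiv.refl _)).tsum_eq fun γ : L.lattice => f γ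
  have h3 : Summable fun p : ℤ × ℤ => f (p.2 * L.ω₁ + p.1 * L.ω₂) := by
    have := ((Equiv.prodComm ℤ ℤ).trans L.latticeEquivProd.symm.toEquiv).summable_iff.2 hf
    refine this.congr fun p => ?_
    simp [h1]
  rw [← ((Equiv.prodComm ℤ ℤ).trans L.latticeEquivProd.symm.toEquiv).tsum_eq
    fun γ : L.lattice => f γ, ← h3.tsum_prod]
  refine tsum_congr fun p => ?_
  simp [h1]

theorem im_period (L : PeriodPair) :
    L.ω₂ * conj L.ω₁ - L.ω₁ * conj L.ω₂ = 2 * Real.pi * I * areaConst L := by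
  have h := sub_conj (L.ω₂ * conj L.ω₁)
  rw [map_mul, conj_conj, mul_comm (conj L.ω₂)] at h
  rw [h, areaConst]
  have hpi : (Real.pi : ℂ) ≠ 0 := by exact_mod_cast Real.pi_ne_zero
  push_cast
  field_simp

/-- The algebra behind two successive one-dimensional Poisson summations. Here `u, v` stand for the
periods and `u', v'` for their conjugates, treated as independent variables, and `D / (2A)` stands
for `πi`. -/
theorem poisson_exponent {u u' v v' A t D : ℂ} (hu : u ≠ 0) (hu' : u' ≠ 0) (hA : A ≠ 0) (ht : t ≠ 0)
    (hD : D ≠ 0) (hv : v * u' - u * v' = D) (a b l k : ℂ) :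
    (((a * v + b * v') / A - (a * u + b * u') * (u * v' + u' * v) / (2 * A * (u * u')) -
        D / (2 * A) * (-k) * (u * v' + u' * v) / (u * u')) + 2 * (D / (2 * A)) * l) ^ 2 /
          (4 * (-(D / (2 * A)) ^ 2 * t * A / (u * u'))) +
        ((a * u + b * u') / A + 2 * (D / (2 * A)) * (-k)) ^ 2 / (4 * (t * (u * u') / A)) =
      a * b / (t * A) + (-(1 / t) * ((l * u + k * v) * (l * u' + k * v')) +
        -a / t * (l * u + k * v) + b / t * (l * u' + k * v')) / A := by
  obtain rfl : v = (D + u * v') / u' := by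
    field_simp
    linear_combination hv
  field_simp
  ring

set_option maxHeartbeats 1000000 in
/-- Poisson summation for `gaussSum`. -/
theorem gaussSum_eq {L : PeriodPair} (hA : 0 < areaConst L) {t : ℝ} (ht : 0 < t) (a b : ℂ) :
    gaussSum L t a b = (t : ℂ)⁻¹ * cexp (a * b / (t * areaConst L)) *
      gaussSum L (1 / t) (-a / t) (b / t) := by
  have hu0 : L.ω₁ ≠ 0 := by
    intro h
    simp [areaConst, h] at hA
  have hpi : (Real.pi : ℂ) ≠ 0 := by exact_mod_cast Real.pi_ne_zero
  have hD := im_period L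
  set A := areaConst L with hAdef
  have hAc : (A : ℂ) ≠ 0 := by exact_mod_cast hA.ne'
  have htc : (t : ℂ) ≠ 0 := by exact_mod_cast ht.ne'
  set p : ℝ := normSq L.ω₁ with hp
  have hp0 : 0 < p := normSq_pos.2 hu0
  have hpc : (p : ℂ) = L.ω₁ * conj L.ω₁ := (mul_conj _).symm
  set Q : ℝ := 2 * (L.ω₁ * conj L.ω₂).re with hQ
  have hQc : (Q : ℂ) = L.ω₁ * conj L.ω₂ + conj L.ω₁ * L.ω₂ := by
    have := add_conj (L.ω₁ * conj L.ω₂)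
    rw [map_mul, conj_conj] at this
    rw [this]
  have hpc0 : (p : ℂ) ≠ 0 := by exact_mod_cast hp0.ne'
  have hu1 : conj L.ω₁ ≠ 0 := by simpa using hu0
  set α : ℂ := a * L.ω₁ + b * conj L.ω₁ with hα
  set β : ℂ := a * L.ω₂ + b * conj L.ω₂ with hβ
  set c₁ : ℝ := t * p / A with hc₁
  set c₂ : ℝ := Real.pi ^ 2 * t * A / p with hc₂
  set c₃ : ℝ := Real.pi ^ 2 * A / (t * p) with hc₃
  have hc₁0 : 0 < c₁ := by positivity
  have hc₂0 : 0 < c₂ := by positivity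
  have hc₃0 : 0 < c₃ := by positivity
  -- The first Poisson summation runs along `ω₁`, with the `ω₂`-coordinate `n` held fixed.
  have hL : gaussSum L t a b = (Real.sqrt (Real.pi / c₁) : ℂ) * ∑' (n : ℤ) (k : ℤ),
      cexp ((α / A - t * n * Q / A + 2 * Real.pi * I * k) ^ 2 / (4 * c₁) +
        (-t * n ^ 2 * (L.ω₂ * conj L.ω₂) + n * β) / A) := by
    rw [gaussSum, tsum_lattice_eq (fun γ => cexp ((-t * (γ * conj γ) + a * γ + b * conj γ) / A))
      (summable_gaussSum hA ht a b), ← tsum_mul_left]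
    refine tsum_congr fun n => ?_
    simp only [exp_add _ ((-t * n ^ 2 * (L.ω₂ * conj L.ω₂) + n * β) / A)]
    rw [tsum_mul_right, ← mul_assoc, ← tsum_cexp_int_sq hc₁0, ← tsum_mul_right]
    refine tsum_congr fun m => ?_
    rw [← exp_add]
    congr 1
    simp only [map_add, map_mul, map_intCast, hα, hβ, hQc, hc₁]
    push_cast
    rw [hpc]
    field_simp
    ring
  have hπ : (Real.pi : ℂ) * I = (L.ω₂ * conj L.ω₁ - L.ω₁ * conj L.ω₂) / (2 * A) := by
    rw [hD]
    field_simp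
  have hπ2 : (Real.pi : ℂ) ^ 2 = - ((L.ω₂ * conj L.ω₁ - L.ω₁ * conj L.ω₂) / (2 * A)) ^ 2 := by
    rw [← hπ, mul_pow, I_sq]
    ring
  have hD0 : L.ω₂ * conj L.ω₁ - L.ω₁ * conj L.ω₂ ≠ 0 := by
    rw [hD]
    simp [hAc, hpi, I_ne_zero]
  have hexp1 : ∀ n k : ℤ, (α / A - t * n * Q / A + 2 * Real.pi * I * k) ^ 2 / (4 * c₁) +
        (-t * n ^ 2 * (L.ω₂ * conj L.ω₂) + n * β) / A =
      (-c₂ * n ^ 2 + (β / A - α * Q / (2 * A * p) - Real.pi * I * k * Q / p) * n) +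
        (α / A + 2 * Real.pi * I * k) ^ 2 / (4 * c₁) := by
    intro n k
    simp only [hc₁, hc₂]
    push_cast
    rw [hπ2, mul_assoc (2 : ℂ) _ I, hπ, hQc, hpc]
    field_simp
    ring
  have hexp2 : ∀ l k : ℤ, ((β / A - α * Q / (2 * A * p) - Real.pi * I * (-k : ℤ) * Q / p) +
        2 * Real.pi * I * l) ^ 2 / (4 * c₂) + (α / A + 2 * Real.pi * I * (-k : ℤ)) ^ 2 / (4 * c₁) =
      a * b / (t * A) + (-(1 / t : ℝ) * ((l * L.ω₁ + k * L.ω₂) * conj (l * L.ω₁ + k * L.ω₂)) +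
        -a / t * (l * L.ω₁ + k * L.ω₂) + b / t * conj (l * L.ω₁ + k * L.ω₂)) / A := by
    intro l k
    simp only [hc₁, hc₂, map_add, map_mul, map_intCast, hα, hβ]
    push_cast
    rw [hπ2, mul_assoc (2 : ℂ) _ I, hπ, hQc, hpc]
    exact poisson_exponent hu0 hu1 hAc htc hD0 rfl a b l k
  -- The cross term in `n` and `k` is purely imaginary, so the norm of the summand factors into two
  -- one-dimensional Gaussians. This permits exchanging the sums before the second Poisson
  -- summation, along `ω₂`.
  have hsum : Summable fun q : ℤ × ℤ =>
      cexp ((α / A - t * q.1 * Q / A + 2 * Real.pi * I * q.2) ^ 2 / (4 * c₁) +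
        (-t * q.1 ^ 2 * (L.ω₂ * conj L.ω₂) + q.1 * β) / A) := by
    have s1 := (summable_cexp_int_sq hc₂0 (β / A - α * Q / (2 * A * p))).norm
    have s2 := (summable_cexp_int_sq hc₃0 (Real.pi * I * α / (t * p))).norm
    have s3 := (s1.mul_of_nonneg s2 (fun _ => norm_nonneg _) (fun _ => norm_nonneg _)).mul_left
      ‖cexp (α ^ 2 / (4 * A * t * p))‖
    refine Summable.of_norm_bounded s3 fun q => le_of_eq ?_
    rw [hexp1, ← norm_mul, ← norm_mul, ← exp_add, ← exp_add, norm_exp, norm_exp]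
    congr 1
    have : (-c₂ * q.1 ^ 2 + (β / A - α * Q / (2 * A * p) - Real.pi * I * q.2 * Q / p) * q.1) +
        (α / A + 2 * Real.pi * I * q.2) ^ 2 / (4 * c₁) = (α ^ 2 / (4 * A * t * p) +
          (-c₂ * q.1 ^ 2 + (β / A - α * Q / (2 * A * p)) * q.1 +
            (-c₃ * q.2 ^ 2 + Real.pi * I * α / (t * p) * q.2))) +
          ((-(Real.pi * q.2 * Q / p * q.1) : ℝ) : ℂ) * I := by
      simp only [hc₁, hc₃]
      push_cast
      field_simp
      ring_nf
      simp only [I_sq]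
      ring
    rw [this, add_re, re_ofReal_mul, I_re, mul_zero, add_zero]
  have hS := summable_gaussSum hA (one_div_pos.2 ht) (-a / t) (b / t)
  -- The substitution `k ↦ -k` turns the two dual frequencies into the coordinates of a lattice
  -- vector `l ω₁ + k ω₂`.
  rw [hL, ← Summable.tsum_comm (f := fun n k : ℤ => cexp ((α / A - t * n * Q / A +
      2 * Real.pi * I * k) ^ 2 / (4 * c₁) + (-t * n ^ 2 * (L.ω₂ * conj L.ω₂) + n * β) / A)) hsum,
    gaussSum, tsum_lattice_eq (fun γ => cexp ((-(1 / t : ℝ) * (γ * conj γ) +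
    -a / t * γ + b / t * conj γ) / A)) hS, ← (Equiv.neg ℤ).tsum_eq, ← tsum_mul_left, ← tsum_mul_left]
  refine tsum_congr fun k => ?_
  simp only [hexp1, Equiv.neg_apply]
  simp only [exp_add _ ((α / A + 2 * Real.pi * I * _) ^ 2 / (4 * (c₁ : ℂ)))]
  rw [tsum_mul_right, tsum_cexp_int_sq hc₂0, mul_assoc, ← tsum_mul_right, ← mul_assoc,
    ← tsum_mul_left, ← tsum_mul_left]
  refine tsum_congr fun l => ?_
  rw [← exp_add, hexp2, exp_add, ← ofReal_mul, ← Real.sqrt_mul (by positivity), ← mul_assoc]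
  congr 2
  have : Real.pi / c₁ * (Real.pi / c₂) = t⁻¹ ^ 2 := by
    simp only [hc₁, hc₂]
    field_simp
  rw [this, Real.sqrt_sq (by positivity), ofReal_inv]

/-! ### Theta functions with characters -/

/-- Discreteness of the lattice. Excluding only `z₀ + γ = 0` gives one constant that serves whether
or not `z₀` is a lattice point. -/
theorem exists_norm_add_ge (L : PeriodPair) (z₀ : ℂ) :
    ∃ m : ℝ, 0 < m ∧ ∀ γ : L.lattice, z₀ + (γ : ℂ) ≠ 0 → m ≤ ‖z₀ + (γ : ℂ)‖ := by
  obtain ⟨m, hm, h⟩ := Metric.mem_nhds_iff.1 (L.compl_lattice_sdiff_singleton_mem_nhds (-z₀))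
  refine ⟨m, hm, fun γ hγ => ?_⟩
  by_contra! hlt
  have h1 : (γ : ℂ) ∈ Metric.ball (-z₀) m := by
    rw [Metric.mem_ball, dist_eq_norm, sub_neg_eq_add, add_comm]
    exact hlt
  refine h h1 ⟨γ.2, fun h2 => hγ ?_⟩
  rw [mem_singleton_iff.1 h2]
  ring

theorem summable_norm_pow_mul_exp (L : PeriodPair) (z₀ : ℂ) (n : ℕ) {c : ℝ} (hc : 0 < c) (d : ℝ) :
    Summable fun γ : L.lattice =>
      ‖z₀ + (γ : ℂ)‖ ^ n * Real.exp (-c * ‖z₀ + (γ : ℂ)‖ ^ 2 + d * ‖z₀ + (γ : ℂ)‖) := by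
  have h := (summable_exp_neg_sq L hc (2 * c * ‖z₀‖ + |d + 1|)).mul_left
    (n ! * Real.exp (|d + 1| * ‖z₀‖))
  refine Summable.of_nonneg_of_le (fun γ => by positivity) (fun γ => ?_) h
  set x := ‖z₀ + (γ : ℂ)‖
  set y := ‖(γ : ℂ)‖
  have hx : 0 ≤ x := norm_nonneg _
  have h1 : |y - ‖z₀‖| ≤ x := by
    have := abs_norm_sub_norm_le (γ : ℂ) (-z₀)
    rwa [norm_neg, sub_neg_eq_add, add_comm (γ : ℂ)] at this
  have h2 : x ≤ ‖z₀‖ + y := norm_add_le _ _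
  have h3 : (y - ‖z₀‖) ^ 2 ≤ x ^ 2 := sq_le_sq.2 (by rwa [abs_of_nonneg hx])
  have h4 : x ^ n ≤ n ! * Real.exp x := by
    have := Real.pow_div_factorial_le_exp x hx n
    rwa [div_le_iff₀ (by positivity), mul_comm] at this
  have h5 : (d + 1) * x ≤ |d + 1| * (‖z₀‖ + y) :=
    (mul_le_mul_of_nonneg_right (le_abs_self _) hx).trans
      (mul_le_mul_of_nonneg_left h2 (abs_nonneg _))
  calc x ^ n * Real.exp (-c * x ^ 2 + d * x)
      ≤ (n ! * Real.exp x) * Real.exp (-c * x ^ 2 + d * x) := by gcongr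
    _ = n ! * Real.exp (-c * x ^ 2 + (d + 1) * x) := by
      rw [mul_assoc, ← Real.exp_add]
      ring_nf
    _ ≤ n ! * Real.exp (|d + 1| * ‖z₀‖ + (-c * y ^ 2 + (2 * c * ‖z₀‖ + |d + 1|) * y)) := by
      refine mul_le_mul_of_nonneg_left (Real.exp_le_exp.2 ?_) (by positivity)
      have := mul_le_mul_of_nonneg_left h3 hc.le
      nlinarith [mul_nonneg hc.le (sq_nonneg ‖z₀‖)]
    _ = _ := by rw [Real.exp_add, mul_assoc (n ! : ℝ)]

/-- The term of `thetaSum` at `x = z₀ + γ`. -/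
noncomputable def thetaTerm (L : PeriodPair) (n : ℕ) (t : ℝ) (u z₀ w₀ : ℂ) (γ : L.lattice) : ℂ :=
  conj (z₀ + (γ : ℂ)) ^ n * cexp (u * conj (z₀ + (γ : ℂ))) *
    (Real.exp (-(t / areaConst L) * ‖z₀ + (γ : ℂ)‖ ^ 2) : ℂ) * pairing L γ w₀

/-- `∑ conj x ^ n * exp(u * conj x - t |x|² / A) * ⟨γ, w₀⟩`, with `x = z₀ + γ`. -/
noncomputable def thetaSum (L : PeriodPair) (n : ℕ) (t : ℝ) (u z₀ w₀ : ℂ) : ℂ :=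
  ∑' γ : L.lattice, thetaTerm L n t u z₀ w₀ γ

theorem norm_pairing (L : PeriodPair) (z w : ℂ) : ‖pairing L z w‖ = 1 := by
  have : (z * conj w - w * conj z) / (areaConst L : ℂ) =
      ((2 * (z * conj w).im / areaConst L : ℝ) : ℂ) * I := by
    have := sub_conj (z * conj w)
    rw [map_mul, conj_conj, mul_comm (conj z)] at this
    rw [this]
    push_cast
    ring
  rw [pairing, this, norm_exp_ofReal_mul_I]

theorem norm_thetaTerm_le (L : PeriodPair) (n : ℕ) (t : ℝ) (u z₀ w₀ : ℂ) (γ : L.lattice) :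
    ‖thetaTerm L n t u z₀ w₀ γ‖ ≤ ‖z₀ + (γ : ℂ)‖ ^ n *
      Real.exp (-(t / areaConst L) * ‖z₀ + (γ : ℂ)‖ ^ 2 + ‖u‖ * ‖z₀ + (γ : ℂ)‖) := by
  rw [thetaTerm, norm_mul, norm_pairing, mul_one, norm_mul, norm_mul, norm_pow, norm_conj, norm_real,
    Real.norm_of_nonneg (Real.exp_pos _).le, mul_assoc, Real.exp_add,
    mul_comm (Real.exp (-(t / areaConst L) * _))]
  refine mul_le_mul_of_nonneg_left (mul_le_mul_of_nonneg_right ?_ (Real.exp_pos _).le)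
    (by positivity)
  refine (norm_exp_le_exp_norm _).trans ?_
  rw [norm_mul, norm_conj]

theorem summable_thetaTerm {L : PeriodPair} (hA : 0 < areaConst L) (n : ℕ) {t : ℝ} (ht : 0 < t)
    (u z₀ w₀ : ℂ) : Summable (thetaTerm L n t u z₀ w₀) :=
  Summable.of_norm_bounded (summable_norm_pow_mul_exp L z₀ n (div_pos ht hA) ‖u‖)
    (norm_thetaTerm_le L n t u z₀ w₀)

theorem hasDerivAt_thetaTerm (L : PeriodPair) (n : ℕ) (t : ℝ) (u z₀ w₀ : ℂ) (γ : L.lattice) :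
    HasDerivAt (fun u => thetaTerm L n t u z₀ w₀ γ) (thetaTerm L (n + 1) t u z₀ w₀ γ) u := by
  simp only [thetaTerm]
  have h1 : HasDerivAt (fun y : ℂ => cexp (y * conj (z₀ + (γ : ℂ))))
      (cexp (u * conj (z₀ + (γ : ℂ))) * (1 * conj (z₀ + (γ : ℂ)))) u :=
    ((hasDerivAt_id u).mul_const _).cexp
  refine (((h1.const_mul (conj (z₀ + (γ : ℂ)) ^ n)).mul_const
    (Real.exp (-(t / areaConst L) * ‖z₀ + (γ : ℂ)‖ ^ 2) : ℂ)).mul_const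
      (pairing L γ w₀)).congr_deriv ?_
  rw [pow_succ]
  ring

/-- This is the purpose of the variable `u`: differentiation in `u` raises `n` by one, so the
functional equation for every `n` follows from the case `n = 0`, which is a pure Gaussian sum. -/
theorem hasDerivAt_thetaSum {L : PeriodPair} (hA : 0 < areaConst L) (n : ℕ) {t : ℝ} (ht : 0 < t)
    (u z₀ w₀ : ℂ) :
    HasDerivAt (fun u => thetaSum L n t u z₀ w₀) (thetaSum L (n + 1) t u z₀ w₀) u := by
  unfold thetaSum
  refine hasDerivAt_tsum_of_isPreconnected (t := Metric.ball u 1) (y₀ := u)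
    (g := fun γ u => thetaTerm L n t u z₀ w₀ γ) (g' := fun γ u => thetaTerm L (n + 1) t u z₀ w₀ γ)
    (summable_norm_pow_mul_exp L z₀ (n + 1) (div_pos ht hA) (‖u‖ + 1)) Metric.isOpen_ball
    (convex_ball u 1).isPreconnected (fun γ y _ => hasDerivAt_thetaTerm L n t y z₀ w₀ γ)
    (fun γ y hy => ?_) (Metric.mem_ball_self one_pos)
    (summable_thetaTerm hA n ht u z₀ w₀) (Metric.mem_ball_self one_pos)
  refine (norm_thetaTerm_le L (n + 1) t y z₀ w₀ γ).trans ?_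
  have : ‖y‖ ≤ ‖u‖ + 1 := by
    have h1 : ‖y - u‖ < 1 := by rwa [← dist_eq_norm]
    have h2 := norm_add_le (y - u) u
    rw [sub_add_cancel] at h2
    linarith
  refine mul_le_mul_of_nonneg_left (Real.exp_le_exp.2 ?_) (by positivity)
  gcongr

theorem thetaSum_zero_eq_gaussSum {L : PeriodPair} (hA : 0 < areaConst L) (t : ℝ) (u z₀ w₀ : ℂ) :
    thetaSum L 0 t u z₀ w₀ = cexp (u * conj z₀ - t * (z₀ * conj z₀) / areaConst L) *
      gaussSum L t (conj w₀ - t * conj z₀) (u * areaConst L - w₀ - t * z₀) := by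
  have hAc : (areaConst L : ℂ) ≠ 0 := by exact_mod_cast hA.ne'
  rw [thetaSum, gaussSum, ← tsum_mul_left]
  refine tsum_congr fun γ => ?_
  rw [thetaTerm, pairing, pow_zero, one_mul, ofReal_exp, ← exp_add, ← exp_add, ← exp_add]
  congr 1
  push_cast
  rw [← mul_conj', map_add]
  field_simp
  ring

/-- The functional equation of the theta functions. -/
theorem thetaSum_functional_equation {L : PeriodPair} (hA : 0 < areaConst L) (n : ℕ) {t : ℝ}
    (ht : 0 < t) (u z₀ w₀ : ℂ) :
    thetaSum L n t u z₀ w₀ =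
      ((t : ℂ) ^ (n + 1))⁻¹ * pairing L w₀ z₀ * thetaSum L n (1 / t) (u / t) w₀ z₀ := by
  have hAc : (areaConst L : ℂ) ≠ 0 := by exact_mod_cast hA.ne'
  have htc : (t : ℂ) ≠ 0 := by exact_mod_cast ht.ne'
  induction n generalizing u with
  | zero =>
    rw [thetaSum_zero_eq_gaussSum hA, thetaSum_zero_eq_gaussSum hA, gaussSum_eq hA ht, pairing]
    have e1 : -(conj w₀ - t * conj z₀) / (t : ℂ) = conj z₀ - ((1 / t : ℝ) : ℂ) * conj w₀ := by
      push_cast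
      field_simp
      ring
    have e2 : (u * areaConst L - w₀ - t * z₀) / t =
        u / t * areaConst L - z₀ - ((1 / t : ℝ) : ℂ) * w₀ := by
      push_cast
      field_simp
      ring
    rw [e1, e2, zero_add, pow_one]
    rw [mul_assoc (t : ℂ)⁻¹ (cexp _), mul_left_comm (cexp _) (t : ℂ)⁻¹, ← mul_assoc (cexp _) (cexp _),
      ← exp_add, mul_assoc (t : ℂ)⁻¹ (cexp _), ← mul_assoc (cexp _) (cexp _), ← exp_add]
    congr 3
    push_cast
    field_simp
    ring
  | succ n ih =>
    have h1 := hasDerivAt_thetaSum hA n ht u z₀ w₀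
    have h2 := ((hasDerivAt_thetaSum hA n (one_div_pos.2 ht) (u / t) w₀ z₀).scomp u
      ((hasDerivAt_id u).div_const (t : ℂ))).const_mul (((t : ℂ) ^ (n + 1))⁻¹ * pairing L w₀ z₀)
    have h3 := h1.unique (h2.congr_of_eventuallyEq (.of_forall fun v => by
      simp only [Function.comp, id]
      exact ih v))
    rw [h3, smul_eq_mul, pow_succ (t : ℂ) (n + 1)]
    field_simp

/-! ### The continuation of the Eisenstein–Kronecker–Lerch series -/

/-- For `n ≥ 1` the factor `conj x ^ n` kills a possible term `x = 0`. The other terms have `|x| ≥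
m`, so passing from time `1` to time `t` gains the factor `exp(-(t - 1) m² / A)`. -/
theorem exists_norm_thetaSum_le {L : PeriodPair} (hA : 0 < areaConst L) {n : ℕ} (hn : 1 ≤ n)
    (z₀ w₀ : ℂ) : ∃ C c : ℝ, 0 < c ∧
      ∀ t : ℝ, 1 ≤ t → ‖thetaSum L n t 0 z₀ w₀‖ ≤ C * Real.exp (-c * t) := by
  obtain ⟨m, hm, hmin⟩ := exists_norm_add_ge L z₀
  have hs := summable_norm_pow_mul_exp L z₀ n (div_pos one_pos hA) 0
  refine ⟨Real.exp (m ^ 2 / areaConst L) * ∑' γ : L.lattice, ‖z₀ + (γ : ℂ)‖ ^ n *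
    Real.exp (-(1 / areaConst L) * ‖z₀ + (γ : ℂ)‖ ^ 2 + 0 * ‖z₀ + (γ : ℂ)‖),
    m ^ 2 / areaConst L, by positivity, fun t ht => ?_⟩
  rw [mul_right_comm, ← Real.exp_add, ← tsum_mul_left]
  refine tsum_of_norm_bounded (hs.mul_left _).hasSum fun γ => ?_
  refine (norm_thetaTerm_le L n t 0 z₀ w₀ γ).trans ?_
  by_cases hx : z₀ + (γ : ℂ) = 0
  · rw [hx, norm_zero, zero_pow (by omega)]
    simp
  · rw [mul_left_comm, ← Real.exp_add, norm_zero]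
    refine mul_le_mul_of_nonneg_left (Real.exp_le_exp.2 ?_) (by positivity)
    have h1 : m ^ 2 ≤ ‖z₀ + (γ : ℂ)‖ ^ 2 := pow_le_pow_left₀ hm.le (hmin γ hx) 2
    have h2 : (t - 1) / areaConst L * m ^ 2 ≤ (t - 1) / areaConst L * ‖z₀ + (γ : ℂ)‖ ^ 2 :=
      mul_le_mul_of_nonneg_left h1 (div_nonneg (by linarith) hA.le)
    have h3 : -(t / areaConst L) * ‖z₀ + (γ : ℂ)‖ ^ 2 =
      -(1 / areaConst L) * ‖z₀ + (γ : ℂ)‖ ^ 2 - (t - 1) / areaConst L * ‖z₀ + (γ : ℂ)‖ ^ 2 := by ring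
    have h4 : m ^ 2 / areaConst L + -(m ^ 2 / areaConst L) * t = -((t - 1) / areaConst L * m ^ 2) := by
      ring
    rw [h3, h4]
    linarith

theorem continuousOn_thetaSum {L : PeriodPair} (hA : 0 < areaConst L) (n : ℕ) (z₀ w₀ : ℂ) :
    ContinuousOn (fun t : ℝ => thetaSum L n t 0 z₀ w₀) (Ioi 0) := by
  intro t ht
  rw [mem_Ioi] at ht
  have h : ContinuousOn (fun t : ℝ => thetaSum L n t 0 z₀ w₀) (Ioi (t / 2)) := by
    unfold thetaSum
    refine continuousOn_tsum (fun γ => ?_)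
      (summable_norm_pow_mul_exp L z₀ n (div_pos (half_pos ht) hA) 0) fun γ s hs => ?_
    · unfold thetaTerm
      fun_prop
    · refine (norm_thetaTerm_le L n s 0 z₀ w₀ γ).trans ?_
      rw [norm_zero]
      refine mul_le_mul_of_nonneg_left (Real.exp_le_exp.2 ?_) (by positivity)
      have : t / 2 / areaConst L ≤ s / areaConst L := by
        have := (mem_Ioi.1 hs).le
        gcongr
      gcongr
  exact (h.continuousAt (Ioi_mem_nhds (half_lt_self ht))).continuousWithinAt

theorem isBigO_thetaSum {L : PeriodPair} (hA : 0 < areaConst L) {n : ℕ} (hn : 1 ≤ n)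
    (z₀ w₀ : ℂ) (r : ℝ) :
    (fun t : ℝ => thetaSum L n t 0 z₀ w₀) =O[atTop] (fun t : ℝ => t ^ r) := by
  obtain ⟨C, c, hc, h⟩ := exists_norm_thetaSum_le hA hn z₀ w₀
  refine IsBigO.trans ?_ (isLittleO_exp_neg_mul_rpow_atTop hc r).isBigO
  refine IsBigO.of_bound C ?_
  filter_upwards [eventually_ge_atTop 1] with t ht
  rw [Real.norm_of_nonneg (Real.exp_pos _).le]
  exact h t ht

theorem pairing_ne_zero (L : PeriodPair) (z w : ℂ) : pairing L z w ≠ 0 := exp_ne_zero _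

/-- The theta functions `thetaSum L n · 0 z₀ w₀` and `thetaSum L n · 0 w₀ z₀` as a pair of functions
related by a functional equation. -/
noncomputable def thetaPair {L : PeriodPair} (hA : 0 < areaConst L) {n : ℕ} (hn : 1 ≤ n)
    (z₀ w₀ : ℂ) : WeakFEPair ℂ where
  f t := thetaSum L n t 0 z₀ w₀
  g t := thetaSum L n t 0 w₀ z₀
  k := n + 1
  ε := pairing L w₀ z₀
  f₀ := 0
  g₀ := 0
  hf_int := (continuousOn_thetaSum hA n z₀ w₀).locallyIntegrableOn measurableSet_Ioi
  hg_int := (continuousOn_thetaSum hA n w₀ z₀).locallyIntegrableOn measurableSet_Ioi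
  hk := by positivity
  hε := pairing_ne_zero L w₀ z₀
  h_feq x hx := by
    rw [mem_Ioi] at hx
    rw [thetaSum_functional_equation hA n (one_div_pos.2 hx), zero_div, one_div_one_div, smul_eq_mul]
    have : x ^ ((n : ℝ) + 1) = x ^ (n + 1) := by
      rw [← Real.rpow_natCast]
      push_cast
      rfl
    rw [this]
    push_cast
    rw [one_div, inv_pow, inv_inv]
    ring
  hf_top r := by simpa using isBigO_thetaSum hA hn z₀ w₀ r
  hg_top r := by simpa using isBigO_thetaSum hA hn w₀ z₀ r

/-- Both constant terms at infinity vanish, so the completed Mellin transform has no poles; this is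
what makes the continuation entire. -/
theorem isStrongFEPair_thetaPair {L : PeriodPair} (hA : 0 < areaConst L) {n : ℕ} (hn : 1 ≤ n)
    (z₀ w₀ : ℂ) : IsStrongFEPair (thetaPair hA hn z₀ w₀) := ⟨rfl, rfl⟩

theorem mellinConvergent_thetaSum {L : PeriodPair} (hA : 0 < areaConst L) {n : ℕ} (hn : 1 ≤ n)
    (z₀ w₀ s : ℂ) : MellinConvergent (fun t => thetaSum L n t 0 z₀ w₀) s :=
  ((isStrongFEPair_thetaPair hA hn z₀ w₀).hasMellin s).1

theorem differentiable_mellin_thetaSum {L : PeriodPair} (hA : 0 < areaConst L) {n : ℕ} (hn : 1 ≤ n)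
    (z₀ w₀ : ℂ) : Differentiable ℂ (mellin fun t => thetaSum L n t 0 z₀ w₀) := by
  have h := (isStrongFEPair_thetaPair hA hn z₀ w₀).differentiable_Λ
  have h2 : (thetaPair hA hn z₀ w₀).Λ = mellin fun t => thetaSum L n t 0 z₀ w₀ :=
    funext fun s => (((isStrongFEPair_thetaPair hA hn z₀ w₀).hasMellin s).2).symm
  rwa [h2] at h

theorem ofReal_sq_div_cpow {r A : ℝ} (hr : 0 < r) (hA : 0 < A) (s : ℂ) :
    ((r ^ 2 / A : ℝ) : ℂ) ^ s = (r : ℂ) ^ (2 * s) / (A : ℂ) ^ s := by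
  have h0 : (r : ℂ) ≠ 0 := by exact_mod_cast hr.ne'
  have h1 : (A : ℂ).arg ≠ Real.pi := by
    rw [arg_ofReal_of_nonneg hA.le]
    exact Real.pi_ne_zero.symm
  rw [div_eq_mul_inv, ofReal_mul, mul_cpow_ofReal_nonneg (sq_nonneg r) (inv_nonneg.2 hA.le), sq,
    ofReal_mul, mul_cpow_ofReal_nonneg hr.le hr.le, two_mul, cpow_add _ _ h0, ofReal_inv,
    inv_cpow _ _ h1, div_eq_mul_inv]

/-- Termwise Mellin transform of `exp(-t |x|² / A)`; the terms with `x = 0` vanish on both sides,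
and absolute convergence needs `n - 2 Re s < -2`. -/
theorem mellin_thetaSum_eq {L : PeriodPair} (hA : 0 < areaConst L) {n : ℕ} (hn : 1 ≤ n)
    (z₀ w₀ : ℂ) {s : ℂ} (hs : (n : ℝ) / 2 + 1 < s.re) :
    mellin (fun t => thetaSum L n t 0 z₀ w₀) s =
      Gamma s * (areaConst L : ℂ) ^ s * lerchSeries L n z₀ w₀ s := by
  have hAc : (areaConst L : ℂ) ≠ 0 := by exact_mod_cast hA.ne'
  have hs0 : 0 < s.re := lt_of_le_of_lt (by positivity) hs
  have key := hasSum_mellin (ι := L.lattice) (a := fun γ => conj (z₀ + (γ : ℂ)) ^ n * pairing L γ w₀)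
    (p := fun γ => ‖z₀ + (γ : ℂ)‖ ^ 2 / areaConst L) (F := fun t => thetaSum L n t 0 z₀ w₀) (s := s)
    (fun γ => ?_) hs0 (fun t ht => ?_) ?_
  · rw [← key.tsum_eq, lerchSeries, ← tsum_mul_left]
    rw [← tsum_subtype_eq_of_support_subset (s := {γ : L.lattice | (γ : ℂ) ≠ -z₀})]
    · refine tsum_congr fun γ => ?_
      have hx : 0 < ‖z₀ + (γ.1 : ℂ)‖ := by
        rw [norm_pos_iff]
        intro h
        exact γ.2 (by linear_combination h)
      rw [ofReal_sq_div_cpow hx hA]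
      have h1 : (areaConst L : ℂ) ^ s ≠ 0 := by simp [cpow_eq_zero_iff, hAc]
      have h2 : (‖z₀ + (γ.1 : ℂ)‖ : ℂ) ^ (2 * s) ≠ 0 := by
        simp only [ne_eq, cpow_eq_zero_iff, not_and_or, ofReal_eq_zero]
        exact Or.inl hx.ne'
      field_simp
    · intro γ hγ h
      refine hγ ?_
      simp [h, zero_pow (by omega : n ≠ 0)]
  · by_cases hx : z₀ + (γ : ℂ) = 0
    · left
      simp [hx, zero_pow (by omega : n ≠ 0)]
    · right
      positivity
  · convert (summable_thetaTerm hA n ht 0 z₀ w₀).hasSum using 2 with γ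
    · rw [thetaTerm, zero_mul, exp_zero, mul_one, mul_right_comm]
      congr 4
      ring
    · rfl
  · have hsum := ZLattice.summable_norm_sub_rpow L.lattice (n - 2 * s.re)
      (by simp; linarith) (-z₀)
    refine Summable.of_nonneg_of_le (fun γ => by positivity) (fun γ => ?_)
      (hsum.mul_left (areaConst L ^ s.re))
    rw [sub_neg_eq_add, add_comm (γ : ℂ), norm_mul, norm_pairing, mul_one, norm_pow, norm_conj]
    rcases (norm_nonneg (z₀ + (γ : ℂ))).eq_or_lt with hx | hx
    · rw [← hx, zero_pow (by omega), zero_div]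
      positivity
    · rw [Real.rpow_sub hx, Real.div_rpow (by positivity) hA.le, Real.rpow_mul hx.le,
        Real.rpow_natCast, Real.rpow_two]
      exact le_of_eq (by field_simp)

theorem exists_isLerchContinuation {L : PeriodPair} (hA : 0 < areaConst L) {n : ℕ} (hn : 1 ≤ n)
    (z₀ w₀ : ℂ) : IsLerchContinuation L n z₀ w₀ (fun s =>
      mellin (fun t => thetaSum L n t 0 z₀ w₀) s * (Gamma s)⁻¹ * (areaConst L : ℂ) ^ (-s)) ∧
    Differentiable ℂ (fun s =>
      mellin (fun t => thetaSum L n t 0 z₀ w₀) s * (Gamma s)⁻¹ * (areaConst L : ℂ) ^ (-s)) := by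
  have hAc : (areaConst L : ℂ) ≠ 0 := by exact_mod_cast hA.ne'
  have hd : Differentiable ℂ (fun s =>
      mellin (fun t => thetaSum L n t 0 z₀ w₀) s * (Gamma s)⁻¹ * (areaConst L : ℂ) ^ (-s)) := by
    refine ((differentiable_mellin_thetaSum hA hn z₀ w₀).mul differentiable_one_div_Gamma).mul
      fun s => ?_
    exact differentiableAt_id.neg.const_cpow (Or.inl hAc)
  refine ⟨⟨fun s _ => (hd.analyticAt s).meromorphicNFAt, fun s hs => ?_⟩, hd⟩
  have hs0 : 0 < s.re := lt_of_le_of_lt (by positivity) hs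
  have hG : Gamma s ≠ 0 := Gamma_ne_zero_of_re_pos hs0
  have hP : (areaConst L : ℂ) ^ s ≠ 0 := by simp [cpow_eq_zero_iff, hAc]
  rw [mellin_thetaSum_eq hA hn z₀ w₀ hs, cpow_neg]
  field_simp

theorem lerchK_eq {L : PeriodPair} (hA : 0 < areaConst L) {n : ℕ} (hn : 1 ≤ n) (z₀ w₀ : ℂ) :
    lerchK L n z₀ w₀ = fun s =>
      mellin (fun t => thetaSum L n t 0 z₀ w₀) s * (Gamma s)⁻¹ * (areaConst L : ℂ) ^ (-s) := by
  have h : ∃ F, IsLerchContinuation L n z₀ w₀ F := ⟨_, (exists_isLerchContinuation hA hn z₀ w₀).1⟩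
  rw [lerchK, dif_pos h]
  exact h.choose_spec.unique (exists_isLerchContinuation hA hn z₀ w₀).1

theorem isLerchContinuation_lerchK {L : PeriodPair} (hA : 0 < areaConst L) {n : ℕ} (hn : 1 ≤ n)
    (z₀ w₀ : ℂ) : IsLerchContinuation L n z₀ w₀ (lerchK L n z₀ w₀) ∧
      Differentiable ℂ (lerchK L n z₀ w₀) := by
  rw [lerchK_eq hA hn]
  exact exists_isLerchContinuation hA hn z₀ w₀

/-! ### The generating function of the Eisenstein–Kronecker numbers -/

theorem integrableOn_pow_mul_exp {c : ℝ} (hc : 0 < c) (k : ℕ) :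
    IntegrableOn (fun t : ℝ => t ^ k * Real.exp (-c * t)) (Ioi 0) ∧
      ∫ t in Ioi (0 : ℝ), t ^ k * Real.exp (-c * t) = k ! / c ^ (k + 1) := by
  have h := Real.integral_rpow_mul_exp_neg_mul_Ioi (a := (k : ℝ) + 1) (r := c) (by positivity) hc
  simp only [add_sub_cancel_right, Real.rpow_natCast, ← neg_mul] at h
  rw [Real.Gamma_nat_eq_factorial, ← Nat.cast_succ, Real.rpow_natCast, one_div, inv_pow,
    ← div_eq_inv_mul] at h
  refine ⟨?_, h⟩
  -- A non-integrable function has integral `0` by convention, while the closed formula is positive;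
  -- hence integrability follows from the value.
  by_contra hni
  rw [integral_undef hni] at h
  exact (by positivity : (0 : ℝ) < (k ! : ℝ) / c ^ (k + 1)).ne h

/-- Half of the exponential is spent on the bound `exp(-c/2)` valid for `t ≥ 1`, the other half on a
Gamma integral. With `c = |x|² / A` the first factor retains Gaussian decay over the lattice. -/
theorem integral_Ioi_one_pow_mul_exp_le {c : ℝ} (hc : 0 < c) (k : ℕ) :
    ∫ t in Ioi (1 : ℝ), t ^ k * Real.exp (-c * t) ≤
      Real.exp (-c / 2) * (k ! * (2 / c) ^ (k + 1)) := by
  obtain ⟨h1, h2⟩ := integrableOn_pow_mul_exp (half_pos hc) k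
  have h3 : IntegrableOn (fun t : ℝ => t ^ k * Real.exp (-c * t)) (Ioi 1) :=
    (integrableOn_pow_mul_exp hc k).1.mono_set (Ioi_subset_Ioi zero_le_one)
  have h4 := h1.mono_set (Ioi_subset_Ioi (zero_le_one' ℝ))
  calc ∫ t in Ioi (1 : ℝ), t ^ k * Real.exp (-c * t)
      ≤ ∫ t in Ioi (1 : ℝ), Real.exp (-c / 2) * (t ^ k * Real.exp (-(c / 2) * t)) := by
        refine setIntegral_mono_on h3 (h4.const_mul _) measurableSet_Ioi fun t ht => ?_
        rw [mem_Ioi] at ht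
        rw [mul_left_comm, ← Real.exp_add]
        refine mul_le_mul_of_nonneg_left (Real.exp_le_exp.2 ?_) (by positivity)
        nlinarith
    _ = Real.exp (-c / 2) * ∫ t in Ioi (1 : ℝ), t ^ k * Real.exp (-(c / 2) * t) :=
        integral_const_mul _ _
    _ ≤ Real.exp (-c / 2) * ∫ t in Ioi (0 : ℝ), t ^ k * Real.exp (-(c / 2) * t) := by
        refine mul_le_mul_of_nonneg_left ?_ (Real.exp_pos _).le
        refine setIntegral_mono_set h1 ?_ (Ioi_subset_Ioi zero_le_one).eventuallyLE
        refine (ae_restrict_iff' measurableSet_Ioi).2 (.of_forall fun t ht => ?_)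
        have : 0 < t := ht
        simp only [Pi.zero_apply]
        positivity
    _ = _ := by
        rw [h2, ← inv_div c 2, inv_pow, div_eq_mul_inv (k ! : ℝ)]

/-- The upper half `∫ t in (1, ∞), t ^ k * θ(t)` of the Mellin transform of a theta function. -/
noncomputable def upperMellin (L : PeriodPair) (n k : ℕ) (z₀ w₀ : ℂ) : ℂ :=
  ∫ t in Ioi (1 : ℝ), (t : ℂ) ^ k * thetaSum L n t 0 z₀ w₀

/-- Riemann's splitting at `t = 1`. Under `t ↦ 1/t` the measure and `t ^ k` give `t ^ (-k-2)`, and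
the functional equation gives `t ^ (a+k+2)`, so the folded half carries the power `t ^ a`: the roles
of `a` and `k` are exchanged together with those of `z₀` and `w₀`. -/
theorem mellin_thetaSum_nat {L : PeriodPair} (hA : 0 < areaConst L) (a k : ℕ) (z₀ w₀ : ℂ) :
    mellin (fun t => thetaSum L (a + k + 1) t 0 z₀ w₀) (k + 1) =
      upperMellin L (a + k + 1) k z₀ w₀ +
        pairing L w₀ z₀ * upperMellin L (a + k + 1) a w₀ z₀ := by
  have hn : 1 ≤ a + k + 1 := by omega
  have hc := mellinConvergent_thetaSum hA hn z₀ w₀ (k + 1)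
  set f : ℝ → ℂ := fun t => thetaSum L (a + k + 1) t 0 z₀ w₀ with hf
  have h1 : mellin f (k + 1) = mellin ((Ioi 1).indicator f) (k + 1) +
      mellin ((Ioc 0 1).indicator f) (k + 1) := by
    have hs : ∀ t : ℝ, ∀ s : Set ℝ, (t : ℂ) ^ ((k + 1 : ℂ) - 1) • s.indicator f t =
        s.indicator (fun t => (t : ℂ) ^ ((k + 1 : ℂ) - 1) • f t) t := by
      intro t s
      by_cases h : t ∈ s <;> simp [h]
    simp only [mellin, hs]
    rw [setIntegral_indicator measurableSet_Ioi, setIntegral_indicator measurableSet_Ioc,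
      Ioi_inter_Ioi, inter_eq_self_of_subset_right Ioc_subset_Ioi_self, max_eq_right zero_le_one,
      ← Ioc_union_Ioi_eq_Ioi (zero_le_one' ℝ), setIntegral_union (Ioc_disjoint_Ioi le_rfl)
        measurableSet_Ioi (hc.mono_set Ioc_subset_Ioi_self)
        (hc.mono_set (Ioi_subset_Ioi zero_le_one)), add_comm]
  have h2 : mellin ((Ioi 1).indicator f) (k + 1) = upperMellin L (a + k + 1) k z₀ w₀ := by
    have hs : ∀ t : ℝ, (t : ℂ) ^ ((k + 1 : ℂ) - 1) • (Ioi 1).indicator f t =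
        (Ioi 1).indicator (fun t : ℝ => (t : ℂ) ^ k * f t) t := by
      intro t
      by_cases h : t ∈ Ioi 1 <;> simp [h]
    simp only [mellin, hs]
    rw [setIntegral_indicator measurableSet_Ioi, Ioi_inter_Ioi, max_eq_right zero_le_one]
    rfl
  have h3 : mellin ((Ioc 0 1).indicator f) (k + 1) =
      pairing L w₀ z₀ * upperMellin L (a + k + 1) a w₀ z₀ := by
    have h4 := mellin_comp_inv ((Ioc 0 1).indicator f) (-(k + 1))
    rw [neg_neg] at h4
    rw [← h4, mellin, upperMellin, ← integral_const_mul]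
    have hs : ∀ t ∈ Ioi (0 : ℝ), (t : ℂ) ^ (-(k + 1 : ℂ) - 1) • (Ioc 0 1).indicator f t⁻¹ =
        (Ici 1).indicator (fun t : ℝ => pairing L w₀ z₀ *
          ((t : ℂ) ^ a * thetaSum L (a + k + 1) t 0 w₀ z₀)) t := by
      intro t ht
      have ht0 : 0 < t := ht
      have htc : (t : ℂ) ≠ 0 := by exact_mod_cast ht0.ne'
      have hmem : t⁻¹ ∈ Ioc (0 : ℝ) 1 ↔ t ∈ Ici 1 := by
        simp [ht0, inv_le_one₀ ht0]
      by_cases h : t ∈ Ici 1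
      · rw [indicator_of_mem (hmem.2 h), indicator_of_mem h, hf]
        simp only
        rw [thetaSum_functional_equation hA _ (inv_pos.2 ht0), zero_div, one_div, inv_inv,
          smul_eq_mul]
        have e : (t : ℂ) ^ (-(k + 1 : ℂ) - 1) = ((t : ℂ) ^ (k + 2))⁻¹ := by
          rw [← cpow_natCast, ← cpow_neg]
          congr 1
          push_cast
          ring
        rw [e]
        push_cast
        rw [inv_pow, inv_inv]
        field_simp
        ring
      · rw [indicator_of_notMem (hmem.not.2 h), indicator_of_notMem h, smul_zero]
    rw [setIntegral_congr_fun measurableSet_Ioi hs, setIntegral_indicator measurableSet_Ici,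
      inter_eq_self_of_subset_right (Ici_subset_Ioi.2 (zero_lt_one' ℝ)),
      integral_Ici_eq_integral_Ioi]
  rw [h1, h2, h3]

theorem ekNumber_eq {L : PeriodPair} (hA : 0 < areaConst L) (a k : ℕ) (z₀ w₀ : ℂ) :
    ekNumber L a (k + 1) z₀ w₀ = (upperMellin L (a + k + 1) k z₀ w₀ +
      pairing L w₀ z₀ * upperMellin L (a + k + 1) a w₀ z₀) / (k ! * (areaConst L : ℂ) ^ (k + 1)) := by
  rw [ekNumber, ← add_assoc, lerchK_eq hA (by omega), Nat.cast_succ]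
  simp only
  rw [mellin_thetaSum_nat hA, Gamma_nat_eq_factorial, cpow_neg, ← Nat.cast_succ, cpow_natCast,
    div_eq_mul_inv, mul_inv, mul_assoc]

/-- The integrand whose integral over `(1, ∞)` contributes to the term `z ^ p.2 * w ^ p.1` of the
generating function. -/
noncomputable def genTerm (L : PeriodPair) (z w z₀ w₀ : ℂ) (γ : L.lattice) (p : ℕ × ℕ) (t : ℝ) : ℂ :=
  (-z) ^ p.2 * (-w) ^ p.1 / (p.1 ! * p.2 ! * (areaConst L : ℂ) ^ (p.1 + p.2 + 1)) *
    ((t : ℂ) ^ p.2 * thetaTerm L (p.1 + p.2 + 1) t 0 z₀ w₀ γ)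

theorem norm_thetaTerm (L : PeriodPair) (n : ℕ) (t : ℝ) (z₀ w₀ : ℂ) (γ : L.lattice) :
    ‖thetaTerm L n t 0 z₀ w₀ γ‖ = ‖z₀ + (γ : ℂ)‖ ^ n *
      Real.exp (-(‖z₀ + (γ : ℂ)‖ ^ 2 / areaConst L) * t) := by
  rw [thetaTerm, norm_mul, norm_pairing, mul_one, zero_mul, exp_zero, mul_one, norm_mul, norm_pow,
    norm_conj, norm_real, Real.norm_of_nonneg (Real.exp_pos _).le]
  congr 2
  ring

theorem genTerm_eq_zero {L : PeriodPair} (z w w₀ : ℂ) {z₀ : ℂ} {γ : L.lattice}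
    (h : z₀ + (γ : ℂ) = 0) (p : ℕ × ℕ) (t : ℝ) : genTerm L z w z₀ w₀ γ p t = 0 := by
  simp [genTerm, thetaTerm, h]

theorem integrableOn_genTerm {L : PeriodPair} (hA : 0 < areaConst L) (z w z₀ w₀ : ℂ) (γ : L.lattice)
    (p : ℕ × ℕ) : IntegrableOn (genTerm L z w z₀ w₀ γ p) (Ioi 1) := by
  by_cases hx : z₀ + (γ : ℂ) = 0
  · simp only [funext (genTerm_eq_zero z w w₀ hx p)]
    exact integrableOn_zero
  have hc : 0 < ‖z₀ + (γ : ℂ)‖ ^ 2 / areaConst L := by positivity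
  have h1 := ((integrableOn_pow_mul_exp hc p.2).1.mono_set (Ioi_subset_Ioi (zero_le_one' ℝ)))
  refine Integrable.const_mul ?_ _
  refine (h1.const_mul (‖z₀ + (γ : ℂ)‖ ^ (p.1 + p.2 + 1))).mono' ?_ ?_
  · refine Continuous.aestronglyMeasurable ?_
    unfold thetaTerm
    fun_prop
  · refine (ae_restrict_iff' measurableSet_Ioi).2 (.of_forall fun t ht => ?_)
    have ht0 : 0 < t := zero_lt_one.trans ht
    rw [norm_mul, norm_thetaTerm, norm_pow, norm_real, Real.norm_of_nonneg ht0.le]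
    exact le_of_eq (by ring)

/-- The domination needed for all later exchanges. The restriction `‖z‖ ≤ m / 4` makes the ratio
`2‖z‖ / |x|` at most `1/2`, hence a geometric series in `p.2`; the sum over `p.1` is exponential in
`|x|` and is absorbed by the Gaussian. -/
theorem integral_norm_genTerm_le {L : PeriodPair} (hA : 0 < areaConst L) (z w z₀ w₀ : ℂ) {m : ℝ}
    (hm : 0 < m) {γ : L.lattice} (hx : z₀ + (γ : ℂ) ≠ 0 → m ≤ ‖z₀ + (γ : ℂ)‖) (hz : ‖z‖ ≤ m / 4)
    (p : ℕ × ℕ) :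
    ∫ t in Ioi (1 : ℝ), ‖genTerm L z w z₀ w₀ γ p t‖ ≤
      2 / m * Real.exp (-(1 / (2 * areaConst L)) * ‖z₀ + (γ : ℂ)‖ ^ 2) *
        ((‖w‖ / areaConst L * ‖z₀ + (γ : ℂ)‖) ^ p.1 / p.1 ! * (1 / 2) ^ p.2) := by
  by_cases hx0 : z₀ + (γ : ℂ) = 0
  · simp only [genTerm_eq_zero z w w₀ hx0 p, norm_zero, integral_zero]
    positivity
  have hx' := hx hx0
  set x := ‖z₀ + (γ : ℂ)‖ with hxdef
  have hx1 : 0 < x := hm.trans_le hx'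
  have hc : 0 < x ^ 2 / areaConst L := by positivity
  have h1 : ∀ t ∈ Ioi (1 : ℝ), ‖genTerm L z w z₀ w₀ γ p t‖ =
      ‖z‖ ^ p.2 * ‖w‖ ^ p.1 / (p.1 ! * p.2 ! * areaConst L ^ (p.1 + p.2 + 1)) * x ^ (p.1 + p.2 + 1) *
        (t ^ p.2 * Real.exp (-(x ^ 2 / areaConst L) * t)) := by
    intro t ht
    have ht0 : 0 < t := zero_lt_one.trans ht
    rw [genTerm, norm_mul, norm_mul ((t : ℂ) ^ _), norm_thetaTerm, norm_pow (t : ℂ), norm_real,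
      Real.norm_of_nonneg ht0.le, norm_div, norm_mul, norm_mul, norm_mul, norm_pow, norm_pow,
      norm_pow, norm_neg, norm_neg, norm_real, Real.norm_of_nonneg hA.le, norm_natCast, norm_natCast]
    ring
  rw [setIntegral_congr_fun measurableSet_Ioi h1, integral_const_mul]
  refine (mul_le_mul_of_nonneg_left (integral_Ioi_one_pow_mul_exp_le hc p.2) (by positivity)).trans ?_
  have h2 : ‖z‖ ^ p.2 * ‖w‖ ^ p.1 / (p.1 ! * p.2 ! * areaConst L ^ (p.1 + p.2 + 1)) *
      x ^ (p.1 + p.2 + 1) * (Real.exp (-(x ^ 2 / areaConst L) / 2) *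
        (p.2 ! * (2 / (x ^ 2 / areaConst L)) ^ (p.2 + 1))) =
      2 / x * Real.exp (-(1 / (2 * areaConst L)) * x ^ 2) *
        ((‖w‖ / areaConst L * x) ^ p.1 / p.1 ! * (2 * ‖z‖ / x) ^ p.2) := by
    have e : -(x ^ 2 / areaConst L) / 2 = -(1 / (2 * areaConst L)) * x ^ 2 := by
      field_simp
    rw [e]
    simp only [div_pow, mul_pow, pow_add, pow_one, ← pow_mul]
    field_simp
    try ring
  rw [h2]
  have h3 : 2 * ‖z‖ / x ≤ 1 / 2 := by
    rw [div_le_div_iff₀ hx1 two_pos]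
    linarith
  gcongr

theorem hasSum_pow_div_factorial (y : ℂ) : HasSum (fun n : ℕ => y ^ n / n !) (cexp y) := by
  rw [exp_eq_exp_ℂ]
  exact NormedSpace.expSeries_div_hasSum_exp y

theorem hasSum_const_mul_mul {𝕜 : Type*} [RCLike 𝕜] (K : 𝕜) {f g : ℕ → 𝕜} {a b : 𝕜}
    (hf : HasSum f a) (hg : HasSum g b) :
    HasSum (fun p : ℕ × ℕ => K * (f p.1 * g p.2)) (K * (a * b)) :=
  HasSum.mul_left K
    (HasSum.mul hf hg (summable_mul_of_summable_norm hf.summable.norm hg.summable.norm))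

theorem hasSum_exp_mul_exp (K c d : ℂ) :
    HasSum (fun p : ℕ × ℕ => K * (c ^ p.1 / p.1 ! * (d ^ p.2 / p.2 !))) (K * (cexp c * cexp d)) := by
  have h := hasSum_const_mul_mul K (hasSum_pow_div_factorial c) (hasSum_pow_div_factorial d)
  exact h

theorem genTerm_aux (A z w t y P E : ℂ) (a k : ℕ) :
    (-z) ^ k * (-w) ^ a / (a ! * k ! * A ^ (a + k + 1)) * (t ^ k * (y ^ (a + k + 1) * E * P)) =
      y / A * P * E * ((-(w * y) / A) ^ a / a ! * ((-(t * z * y) / A) ^ k / k !)) := by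
  have h1 : (-(w * y) / A) ^ a = (-w) ^ a * y ^ a / A ^ a := by
    rw [← neg_mul, div_pow, mul_pow]
  have h2 : (-(t * z * y) / A) ^ k = t ^ k * (-z) ^ k * y ^ k / A ^ k := by
    rw [div_pow, ← mul_pow, ← mul_pow]
    congr 2
    ring
  rw [h1, h2, pow_succ, pow_succ, pow_add, pow_add]
  generalize (-z) ^ k = z'
  generalize (-w) ^ a = w'
  generalize (a ! : ℂ) = a'
  generalize (k ! : ℂ) = k'
  ring

theorem genTerm_eq {L : PeriodPair} (hA : 0 < areaConst L) (z w z₀ w₀ : ℂ) (γ : L.lattice)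
    (p : ℕ × ℕ) (t : ℝ) : genTerm L z w z₀ w₀ γ p t =
      conj (z₀ + (γ : ℂ)) / areaConst L * pairing L γ w₀ *
        (Real.exp (-(t / areaConst L) * ‖z₀ + (γ : ℂ)‖ ^ 2) : ℂ) *
        ((-(w * conj (z₀ + (γ : ℂ))) / areaConst L) ^ p.1 / p.1 ! *
          ((-(t * z * conj (z₀ + (γ : ℂ))) / areaConst L) ^ p.2 / p.2 !)) := by
  have hAc : (areaConst L : ℂ) ≠ 0 := by exact_mod_cast hA.ne'
  rw [genTerm, thetaTerm, zero_mul, exp_zero, mul_one]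
  exact genTerm_aux _ _ _ _ _ _ _ _ _

theorem hasSum_genTerm {L : PeriodPair} (hA : 0 < areaConst L) (z w z₀ w₀ : ℂ) (γ : L.lattice)
    (t : ℝ) : HasSum (fun p => genTerm L z w z₀ w₀ γ p t)
      (conj (z₀ + (γ : ℂ)) / areaConst L * pairing L γ w₀ *
        cexp (-(w * conj (z₀ + (γ : ℂ))) / areaConst L) *
        cexp (-(conj (z₀ + (γ : ℂ)) * (z₀ + (γ : ℂ) + z)) / areaConst L * t)) := by
  have hAc : (areaConst L : ℂ) ≠ 0 := by exact_mod_cast hA.ne'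
  simp only [genTerm_eq hA]
  have e : cexp (-(conj (z₀ + (γ : ℂ)) * (z₀ + (γ : ℂ) + z)) / areaConst L * t) =
      (Real.exp (-(t / areaConst L) * ‖z₀ + (γ : ℂ)‖ ^ 2) : ℂ) *
        cexp (-(t * z * conj (z₀ + (γ : ℂ))) / areaConst L) := by
    rw [ofReal_exp, ← exp_add]
    congr 1
    push_cast
    rw [← mul_conj']
    generalize conj (z₀ + (γ : ℂ)) = y
    field_simp
    ring
  rw [e, mul_assoc (_ * pairing L γ w₀), mul_left_comm (cexp _) (_ : ℂ), ← mul_assoc (_ * pairing L γ w₀)]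
  exact hasSum_exp_mul_exp _ _ _

/-- The term at `x = z₀ + γ` of the closed form of the generating function. -/
noncomputable def genClosed (L : PeriodPair) (z w z₀ w₀ : ℂ) (γ : L.lattice) : ℂ :=
  pairing L γ w₀ *
    cexp (-(conj (z₀ + (γ : ℂ)) * (z₀ + (γ : ℂ) + z + w)) / areaConst L) / (z₀ + (γ : ℂ) + z)

/-- The exponent has negative real part because `|z| < |x|`. Integration divides by `conj x (x + z)
/ A`, and the prefactor `conj x / A` cancels, leaving `1 / (x + z)`. -/
theorem integral_genTerm_sum {L : PeriodPair} (hA : 0 < areaConst L) (z w w₀ : ℂ) {z₀ : ℂ}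
    {γ : L.lattice} (hx : ‖z‖ < ‖z₀ + (γ : ℂ)‖) :
    ∫ t in Ioi (1 : ℝ), (conj (z₀ + (γ : ℂ)) / areaConst L * pairing L γ w₀ *
        cexp (-(w * conj (z₀ + (γ : ℂ))) / areaConst L) *
        cexp (-(conj (z₀ + (γ : ℂ)) * (z₀ + (γ : ℂ) + z)) / areaConst L * t)) =
      genClosed L z w z₀ w₀ γ := by
  have hAc : (areaConst L : ℂ) ≠ 0 := by exact_mod_cast hA.ne'
  rw [genClosed]
  set x := z₀ + (γ : ℂ)
  have hx0 : x ≠ 0 := norm_pos_iff.1 ((norm_nonneg z).trans_lt hx)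
  have hxz : x + z ≠ 0 := by
    intro h
    rw [eq_neg_of_add_eq_zero_left h, norm_neg] at hx
    exact lt_irrefl _ hx
  have hcx : conj x ≠ 0 := by simpa using hx0
  have hre : (-(conj x * (x + z)) / areaConst L).re < 0 := by
    rw [div_ofReal_re, neg_re, mul_add, add_re, conj_mul', ← ofReal_pow, ofReal_re]
    refine div_neg_of_neg_of_pos ?_ hA
    have h1 : |(conj x * z).re| ≤ ‖x‖ * ‖z‖ := (abs_re_le_norm _).trans (by simp)
    have h2 := (abs_le.1 h1).1
    have h3 : ‖x‖ * ‖z‖ < ‖x‖ ^ 2 := by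
      rw [sq]
      exact mul_lt_mul_of_pos_left hx (norm_pos_iff.2 hx0)
    linarith
  rw [integral_const_mul, integral_exp_mul_complex_Ioi hre]
  have e : -(conj x * (x + z + w)) / (areaConst L : ℂ) = -(w * conj x) / areaConst L +
      -(conj x * (x + z)) / areaConst L * ((1 : ℝ) : ℂ) := by
    push_cast
    ring
  rw [e, exp_add]
  field_simp

-- Fubini for the lattice sum, the double power series and the integral: summing over `p` first
-- gives the closed form, summing over `γ` first gives the coefficients. Terms with `x = 0` vanish
-- because the exponent `p.1 + p.2 + 1` is positive.
open Classical in
theorem hasSum_upperMellin {L : PeriodPair} (hA : 0 < areaConst L) {z₀ : ℂ} {m : ℝ} (hm : 0 < m)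
    (hmin : ∀ γ : L.lattice, z₀ + (γ : ℂ) ≠ 0 → m ≤ ‖z₀ + (γ : ℂ)‖) {z : ℂ} (hz : ‖z‖ ≤ m / 4)
    (w w₀ : ℂ) :
    HasSum (fun p : ℕ × ℕ => (-z) ^ p.2 * (-w) ^ p.1 /
        (p.1 ! * p.2 ! * (areaConst L : ℂ) ^ (p.1 + p.2 + 1)) *
          upperMellin L (p.1 + p.2 + 1) p.2 z₀ w₀)
      (∑' γ : L.lattice, if z₀ + (γ : ℂ) = 0 then 0 else genClosed L z w z₀ w₀ γ) := by
  set B : L.lattice × (ℕ × ℕ) → ℝ := fun q =>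
    2 / m * Real.exp (-(1 / (2 * areaConst L)) * ‖z₀ + (q.1 : ℂ)‖ ^ 2) *
        ((‖w‖ / areaConst L * ‖z₀ + (q.1 : ℂ)‖) ^ q.2.1 / q.2.1 ! * (1 / 2) ^ q.2.2) with hB
  have hB0 : 0 ≤ B := fun q => by
    simp only [hB, Pi.zero_apply]
    positivity
  have hfib : ∀ γ : L.lattice, HasSum (fun p => B (γ, p))
      (2 / m * Real.exp (-(1 / (2 * areaConst L)) * ‖z₀ + (γ : ℂ)‖ ^ 2) *
        (Real.exp (‖w‖ / areaConst L * ‖z₀ + (γ : ℂ)‖) * 2)) := by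
    intro γ
    have h1 : HasSum (fun n : ℕ => (‖w‖ / areaConst L * ‖z₀ + (γ : ℂ)‖) ^ n / n !)
        (Real.exp (‖w‖ / areaConst L * ‖z₀ + (γ : ℂ)‖)) := by
      rw [Real.exp_eq_exp_ℝ]
      exact NormedSpace.expSeries_div_hasSum_exp _
    have h2 := hasSum_geometric_two
    have h3 := hasSum_const_mul_mul
      (2 / m * Real.exp (-(1 / (2 * areaConst L)) * ‖z₀ + (γ : ℂ)‖ ^ 2)) h1 h2
    exact h3
  have hBs : Summable B := by
    rw [summable_prod_of_nonneg hB0]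
    refine ⟨fun γ => (hfib γ).summable, ?_⟩
    simp only [fun γ => (hfib γ).tsum_eq]
    have h := (summable_norm_pow_mul_exp L z₀ 0 (c := 1 / (2 * areaConst L)) (by positivity)
      (‖w‖ / areaConst L)).mul_left (2 / m * 2)
    refine h.congr fun γ => ?_
    rw [Real.exp_add]
    ring
  have hN : ∀ γ : L.lattice, ∀ p : ℕ × ℕ,
      ∫ t in Ioi (1 : ℝ), ‖genTerm L z w z₀ w₀ γ p t‖ ≤ B (γ, p) := fun γ p =>
    integral_norm_genTerm_le hA z w z₀ w₀ hm (hmin γ) hz p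
  have hNs : Summable fun q : L.lattice × (ℕ × ℕ) =>
      ∫ t in Ioi (1 : ℝ), ‖genTerm L z w z₀ w₀ q.1 q.2 t‖ :=
    Summable.of_nonneg_of_le (fun q => integral_nonneg fun t => norm_nonneg _)
      (fun q => hN q.1 q.2) hBs
  have hTs : Summable fun q : L.lattice × (ℕ × ℕ) =>
      ∫ t in Ioi (1 : ℝ), genTerm L z w z₀ w₀ q.1 q.2 t :=
    Summable.of_norm_bounded hNs fun q => norm_integral_le_integral_norm _
  have h1 : ∀ γ : L.lattice, HasSum (fun p => ∫ t in Ioi (1 : ℝ), genTerm L z w z₀ w₀ γ p t)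
      (if z₀ + (γ : ℂ) = 0 then 0 else genClosed L z w z₀ w₀ γ) := by
    intro γ
    split_ifs with hx
    · simp only [genTerm_eq_zero z w w₀ hx, integral_zero]
      exact hasSum_zero
    · have hN' := hNs.prod_factor γ
      have h := hasSum_integral_of_summable_integral_norm (F := genTerm L z w z₀ w₀ γ)
        (fun p => integrableOn_genTerm hA z w z₀ w₀ γ p) hN'
      simp only [fun t => (hasSum_genTerm hA z w z₀ w₀ γ t).tsum_eq] at h
      rwa [integral_genTerm_sum hA z w w₀ (by have := hmin γ hx; linarith)] at h
  have h2 : ∀ p : ℕ × ℕ, HasSum (fun γ => ∫ t in Ioi (1 : ℝ), genTerm L z w z₀ w₀ γ p t)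
      ((-z) ^ p.2 * (-w) ^ p.1 / (p.1 ! * p.2 ! * (areaConst L : ℂ) ^ (p.1 + p.2 + 1)) *
          upperMellin L (p.1 + p.2 + 1) p.2 z₀ w₀) := by
    intro p
    have hN' := hNs.prod_symm.prod_factor p
    have h := hasSum_integral_of_summable_integral_norm (F := fun γ => genTerm L z w z₀ w₀ γ p)
      (fun γ => integrableOn_genTerm hA z w z₀ w₀ γ p) hN'
    have e : ∀ t : ℝ, ∑' γ, genTerm L z w z₀ w₀ γ p t = (-z) ^ p.2 * (-w) ^ p.1 /
        (p.1 ! * p.2 ! * (areaConst L : ℂ) ^ (p.1 + p.2 + 1)) *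
          ((t : ℂ) ^ p.2 * thetaSum L (p.1 + p.2 + 1) t 0 z₀ w₀) := fun t => by
      simp only [genTerm, tsum_mul_left, thetaSum]
    simp only [e] at h
    rwa [integral_const_mul] at h
  have h3 := hTs.hasSum.prod_fiberwise h1
  rw [h3.tsum_eq]
  exact ((Equiv.prodComm _ _).hasSum_iff.2 hTs.hasSum).prod_fiberwise h2

open Classical in
/-- The power series with the Eisenstein–Kronecker numbers as coefficients, in closed form. -/
theorem hasSum_ekNumber {L : PeriodPair} (hA : 0 < areaConst L) {z₀ w₀ : ℂ} {m : ℝ} (hm : 0 < m)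
    (hz₀ : ∀ γ : L.lattice, z₀ + (γ : ℂ) ≠ 0 → m ≤ ‖z₀ + (γ : ℂ)‖)
    (hw₀ : ∀ γ : L.lattice, w₀ + (γ : ℂ) ≠ 0 → m ≤ ‖w₀ + (γ : ℂ)‖) {z w : ℂ} (hz : ‖z‖ ≤ m / 4)
    (hw : ‖w‖ ≤ m / 4) :
    HasSum (fun p : ℕ × ℕ+ => (-1 : ℂ) ^ (p.1 + (p.2 : ℕ) - 1) *
        (ekNumber L p.1 p.2 z₀ w₀ / ((p.1 ! : ℂ) * (areaConst L : ℂ) ^ p.1)) *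
          z ^ ((p.2 : ℕ) - 1) * w ^ p.1)
      ((∑' γ : L.lattice, if z₀ + (γ : ℂ) = 0 then 0 else genClosed L z w z₀ w₀ γ) +
        pairing L w₀ z₀ *
          ∑' γ : L.lattice, if w₀ + (γ : ℂ) = 0 then 0 else genClosed L w z w₀ z₀ γ) := by
  have hAc : (areaConst L : ℂ) ≠ 0 := by exact_mod_cast hA.ne'
  have h1 := hasSum_upperMellin hA hm hz₀ hz w w₀
  -- The folded halves form the same series with `(z, z₀)` and `(w, w₀)` exchanged, hence the swap
  -- of indices.
  have h2 := (Equiv.prodComm ℕ ℕ).hasSum_iff.2 (hasSum_upperMellin hA hm hw₀ hw z z₀)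
  have h3 := h1.add (h2.mul_left (pairing L w₀ z₀))
  have h4 := ((Equiv.refl ℕ).prodCongr Equiv.pnatEquivNat).hasSum_iff.2 h3
  convert h4 using 1
  funext ⟨a, b⟩
  obtain ⟨k, rfl⟩ : ∃ k, b = Nat.succPNat k := ⟨b.natPred, (PNat.succPNat_natPred b).symm⟩
  simp only [Function.comp, Equiv.prodCongr_apply, Equiv.refl_apply, Prod.map, Equiv.prodComm_apply,
    Prod.swap, Equiv.pnatEquivNat_apply, Nat.natPred_succPNat, Nat.succPNat_coe, Nat.succ_eq_add_one]
  rw [ekNumber_eq hA, ← add_assoc, Nat.add_sub_cancel, Nat.add_sub_cancel, neg_pow z, neg_pow w,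
    add_comm k a]
  have : (k ! : ℂ) ≠ 0 := by exact_mod_cast k.factorial_ne_zero
  have : (a ! : ℂ) ≠ 0 := by exact_mod_cast a.factorial_ne_zero
  simp only [pow_add, pow_one]
  field_simp

/-! ### The Kronecker series -/

/-- The Gaussian-damped term `exp((-|γ|² + uγ - v conj γ) / A) / (Z + γ)`. -/
noncomputable def dampedTerm (L : PeriodPair) (u v Z : ℂ) (γ : L.lattice) : ℂ :=
  cexp ((-((γ : ℂ) * conj (γ : ℂ)) + u * γ - v * conj (γ : ℂ)) / areaConst L) / (Z + γ)

theorem norm_dampedTerm_le {L : PeriodPair} (hA : 0 < areaConst L) {u v Z : ℂ} {M δ : ℝ}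
    (hδ : 0 < δ) {γ : L.lattice} (hM : ‖u‖ + ‖v‖ ≤ M) (hZ : Z + γ ≠ 0 → δ ≤ ‖Z + (γ : ℂ)‖) :
    ‖dampedTerm L u v Z γ‖ ≤
      Real.exp (-(1 / areaConst L) * ‖(γ : ℂ)‖ ^ 2 + M / areaConst L * ‖(γ : ℂ)‖) * δ⁻¹ := by
  by_cases h : Z + (γ : ℂ) = 0
  · rw [dampedTerm, h, div_zero, norm_zero]
    positivity
  rw [dampedTerm, norm_div, div_eq_mul_inv]
  refine mul_le_mul ?_ (inv_anti₀ hδ (hZ h)) (by positivity) (by positivity)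
  have h1 := norm_cexp_gauss_le (t := 1) hA u (-v) (γ : ℂ)
  rw [ofReal_one, neg_one_mul, neg_mul, ← sub_eq_add_neg, norm_neg] at h1
  refine h1.trans (Real.exp_le_exp.2 ?_)
  gcongr

theorem summable_dampedTerm {L : PeriodPair} (hA : 0 < areaConst L) (u v Z : ℂ) :
    Summable (dampedTerm L u v Z) := by
  obtain ⟨m, hm, hmin⟩ := exists_norm_add_ge L Z
  exact Summable.of_norm_bounded
    ((summable_exp_neg_sq L (one_div_pos.2 hA) ((‖u‖ + ‖v‖) / areaConst L)).mul_right m⁻¹)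
    fun γ => norm_dampedTerm_le hA hm le_rfl (hmin γ)

/-- The sum of `dampedTerm` over the lattice. -/
noncomputable def dampedSum (L : PeriodPair) (u v Z : ℂ) : ℂ := ∑' γ, dampedTerm L u v Z γ

theorem add_coe_ne_zero {L : PeriodPair} {Z : ℂ} (hZ : Z ∉ L.lattice) (γ : L.lattice) :
    Z + (γ : ℂ) ≠ 0 := fun h => hZ (by
  rw [eq_neg_of_add_eq_zero_left h]
  exact neg_mem γ.2)

/-- The prefactor `exp(uZ/A)` combines with `exp(uγ/A)` into `exp(u(Z + γ)/A)`, whose `u`-derivative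
cancels the denominator `Z + γ` and leaves a pure Gaussian sum. -/
theorem hasDerivAt_dampedSum {L : PeriodPair} (hA : 0 < areaConst L) {Z : ℂ} (hZ : Z ∉ L.lattice)
    (u v : ℂ) :
    HasDerivAt (fun u => cexp (u * Z / areaConst L) * dampedSum L u v Z)
      (cexp (u * Z / areaConst L) * (gaussSum L 1 u (-v) / areaConst L)) u := by
  have hAc : (areaConst L : ℂ) ≠ 0 := by exact_mod_cast hA.ne'
  obtain ⟨m, hm, hmin⟩ := exists_norm_add_ge L Z
  set g' : L.lattice → ℂ → ℂ := fun γ u => dampedTerm L u v Z γ * (γ / areaConst L) with hg'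
  set b : L.lattice → ℝ := fun γ => ‖0 + (γ : ℂ)‖ ^ 1 * Real.exp (-(1 / areaConst L) *
    ‖0 + (γ : ℂ)‖ ^ 2 + (‖u‖ + 1 + ‖v‖) / areaConst L * ‖0 + (γ : ℂ)‖) * (m⁻¹ * (areaConst L)⁻¹) with hb
  have hbs : Summable b := (summable_norm_pow_mul_exp L 0 1 (one_div_pos.2 hA) _).mul_right _
  have h1 : HasDerivAt (fun u => dampedSum L u v Z) (∑' γ, g' γ u) u := by
    unfold dampedSum
    refine hasDerivAt_tsum_of_isPreconnected (t := Metric.ball u 1) (y₀ := u)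
      (g := fun γ u => dampedTerm L u v Z γ) (g' := g') hbs Metric.isOpen_ball
      (convex_ball u 1).isPreconnected (fun γ y _ => ?_)
      (fun γ y hy => ?_) (Metric.mem_ball_self one_pos)
      (summable_dampedTerm hA u v Z) (Metric.mem_ball_self one_pos)
    · have h2 : HasDerivAt (fun y : ℂ => (-((γ : ℂ) * conj (γ : ℂ)) + y * γ - v * conj (γ : ℂ)) /
          (areaConst L : ℂ)) (1 * γ / areaConst L) y :=
        ((((hasDerivAt_id y).mul_const (γ : ℂ)).const_add _).sub_const _).div_const _
      refine (h2.cexp.div_const (Z + γ)).congr_deriv ?_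
      simp only [hg', dampedTerm]
      ring
    · have hy' : ‖y‖ + ‖v‖ ≤ ‖u‖ + 1 + ‖v‖ := by
        have h1 : ‖y - u‖ < 1 := by rwa [← dist_eq_norm]
        have h2 := norm_add_le (y - u) u
        rw [sub_add_cancel] at h2
        linarith
      have h3 := norm_dampedTerm_le hA hm hy' (hmin γ)
      simp only [hg', hb, zero_add, pow_one]
      rw [norm_mul, norm_div, norm_real, Real.norm_of_nonneg hA.le, div_eq_mul_inv]
      calc _ ≤ _ := mul_le_mul_of_nonneg_right h3 (by positivity)
        _ = _ := by ring
  have h2 : HasDerivAt (fun u => cexp (u * Z / areaConst L))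
      (cexp (u * Z / areaConst L) * (1 * Z / areaConst L)) u :=
    (((hasDerivAt_id u).mul_const Z).div_const _).cexp
  refine (h2.mul h1).congr_deriv ?_
  have hs : Summable fun γ => g' γ u := by
    refine Summable.of_norm_bounded hbs fun γ => ?_
    have h3 := norm_dampedTerm_le (u := u) (v := v) (M := ‖u‖ + 1 + ‖v‖) hA hm (by linarith) (hmin γ)
    simp only [hg', hb, zero_add, pow_one]
    rw [norm_mul, norm_div, norm_real, Real.norm_of_nonneg hA.le, div_eq_mul_inv]
    calc _ ≤ _ := mul_le_mul_of_nonneg_right h3 (by positivity)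
      _ = _ := by ring
  rw [mul_assoc, ← mul_add, dampedSum, ← tsum_mul_left,
    ← ((summable_dampedTerm hA u v Z).mul_left _).tsum_add hs, gaussSum, ← tsum_div_const]
  congr 1
  refine tsum_congr fun γ => ?_
  have := add_coe_ne_zero hZ γ
  simp only [hg', dampedTerm]
  rw [ofReal_one, neg_one_mul, neg_mul v, ← sub_eq_add_neg]
  field_simp

/-- The sum `∑ exp(-conj γ (γ + Z + W) / A) (exp(μ(Z + γ) / A) / (Z + γ) + exp(-μ(W + γ) / A) / (W + γ))`,
which turns out to be independent of `μ`. -/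
noncomputable def kroneckerSeries (L : PeriodPair) (μ Z W : ℂ) : ℂ :=
  cexp (μ * Z / areaConst L) * dampedSum L μ (Z + W) Z +
    cexp (-μ * W / areaConst L) * dampedSum L (-μ) (Z + W) W

theorem kroneckerSeries_eq {L : PeriodPair} (hA : 0 < areaConst L) {Z W : ℂ} (hZ : Z ∉ L.lattice)
    (hW : W ∉ L.lattice) (μ : ℂ) : kroneckerSeries L μ Z W = kroneckerSeries L 0 Z W := by
  have hd : ∀ μ, HasDerivAt (fun μ => kroneckerSeries L μ Z W) 0 μ := by
    intro μ
    have h1 := hasDerivAt_dampedSum hA hZ μ (Z + W)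
    have h2 := (hasDerivAt_dampedSum hA hW (-μ) (Z + W)).scomp μ (hasDerivAt_neg μ)
    refine (h1.add h2).congr_deriv ?_
    -- At the self-dual point `t = 1`, Poisson summation maps the Gaussian sum at `μ` to the one at
    -- `-μ`, and the derivatives of the two halves cancel.
    rw [gaussSum_eq hA one_pos μ, smul_eq_mul]
    simp only [ofReal_one, div_one, inv_one, one_mul]
    have e : cexp (-μ * W / areaConst L) =
        cexp (μ * Z / areaConst L) * cexp (μ * -(Z + W) / areaConst L) := by
      rw [← exp_add]
      congr 1
      ring
    rw [e]
    ring
  exact is_const_of_deriv_eq_zero (fun μ => (hd μ).differentiableAt) (fun μ => (hd μ).deriv) μ 0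

theorem kroneckerSeries_zero (L : PeriodPair) (Z W : ℂ) :
    kroneckerSeries L 0 Z W = dampedSum L 0 (Z + W) Z + dampedSum L 0 (Z + W) W := by
  simp [kroneckerSeries]

theorem pairing_lattice {L : PeriodPair} (hA : 0 < areaConst L) {γ l : ℂ} (hγ : γ ∈ L.lattice)
    (hl : l ∈ L.lattice) : pairing L γ l = 1 := by
  have hAc : (areaConst L : ℂ) ≠ 0 := by exact_mod_cast hA.ne'
  obtain ⟨m, n, rfl⟩ := PeriodPair.mem_lattice.1 hγ
  obtain ⟨p, q, rfl⟩ := PeriodPair.mem_lattice.1 hl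
  have e : ((m * L.ω₁ + n * L.ω₂) * conj (p * L.ω₁ + q * L.ω₂) -
      (p * L.ω₁ + q * L.ω₂) * conj (m * L.ω₁ + n * L.ω₂)) / (areaConst L : ℂ) =
      ((n * p - m * q : ℤ) : ℂ) * (2 * Real.pi * I) := by
    have h := im_period L
    simp only [map_add, map_mul, map_intCast]
    field_simp
    push_cast
    linear_combination (n * p - m * q : ℂ) * h
  rw [pairing, e, exp_int_mul_two_pi_mul_I]

theorem kroneckerSeries_add_period {L : PeriodPair} (hA : 0 < areaConst L) {Z W : ℂ}
    (hZ : Z ∉ L.lattice) (hW : W ∉ L.lattice) (l : L.lattice) :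
    kroneckerSeries L 0 (Z + l) W =
      cexp (W * conj (l : ℂ) / areaConst L) * kroneckerSeries L 0 Z W := by
  have hAc : (areaConst L : ℂ) ≠ 0 := by exact_mod_cast hA.ne'
  -- With `μ = conj l` both halves match term by term: the first after the shift `γ ↦ γ - l`, the
  -- second through `⟨γ, l⟩ = 1`.
  rw [← kroneckerSeries_eq hA hZ hW (conj (l : ℂ)), kroneckerSeries_zero, kroneckerSeries, mul_add,
    dampedSum, dampedSum, dampedSum, dampedSum, ← (Equiv.subRight l).tsum_eq]
  simp only [← tsum_mul_left]
  congr 1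
  · refine tsum_congr fun γ => ?_
    simp only [Equiv.subRight_apply, dampedTerm, AddSubgroupClass.coe_sub, map_sub]
    rw [show Z + (l : ℂ) + ((γ : ℂ) - l) = Z + γ by ring, mul_div_assoc', mul_div_assoc', ← exp_add, ← exp_add]
    congr 2
    field_simp
    ring
  · refine tsum_congr fun γ => ?_
    have h := pairing_lattice hA γ.2 l.2
    rw [pairing] at h
    simp only [dampedTerm]
    rw [mul_div_assoc', mul_div_assoc', ← exp_add, ← exp_add, ← mul_one (cexp (_ + _)), ← h,
      ← exp_add]
    congr 2
    field_simp
    ring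

/-- The generating function in terms of the Kronecker series. -/
theorem tsum_genClosed_add {L : PeriodPair} (hA : 0 < areaConst L) {z w z₀ w₀ : ℂ}
    (hz : z + z₀ ∉ L.lattice) (hw : w + w₀ ∉ L.lattice) :
    (∑' γ, genClosed L z w z₀ w₀ γ) + pairing L w₀ z₀ * ∑' γ, genClosed L w z w₀ z₀ γ =
      cexp (-(z₀ * conj w₀) / areaConst L) * cexp (-(z * conj w₀ + w * conj z₀) / areaConst L) *
        kroneckerSeries L 0 (z + z₀) (w + w₀) := by
  have hAc : (areaConst L : ℂ) ≠ 0 := by exact_mod_cast hA.ne'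
  -- This `μ` produces the characters `⟨γ, w₀⟩` and `⟨γ, z₀⟩` in the two halves simultaneously.
  rw [← kroneckerSeries_eq hA hz hw (conj w₀ - conj z₀), kroneckerSeries, mul_add, dampedSum,
    dampedSum]
  simp only [← tsum_mul_left]
  congr 1
  · refine tsum_congr fun γ => ?_
    rw [genClosed, pairing, dampedTerm, show z₀ + (γ : ℂ) + z = z + z₀ + γ by ring]
    simp only [mul_div_assoc', ← exp_add, map_add]
    congr 2
    field_simp
    ring
  · refine tsum_congr fun γ => ?_
    rw [genClosed, pairing, pairing, dampedTerm, show w₀ + (γ : ℂ) + w = w + w₀ + γ by ring]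
    simp only [mul_div_assoc', ← exp_add, map_add]
    congr 2
    field_simp
    ring

theorem summable_genClosed {L : PeriodPair} (hA : 0 < areaConst L) (z w z₀ w₀ : ℂ) :
    Summable (genClosed L z w z₀ w₀) := by
  have hAc : (areaConst L : ℂ) ≠ 0 := by exact_mod_cast hA.ne'
  refine ((summable_dampedTerm hA (conj w₀ - conj z₀) (z + z₀ + (w + w₀)) (z + z₀)).mul_left
    (cexp (-(conj z₀ * (z₀ + z + w)) / areaConst L))).congr fun γ => ?_
  rw [genClosed, pairing, dampedTerm, show z₀ + (γ : ℂ) + z = z + z₀ + γ by ring]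
  simp only [mul_div_assoc', ← exp_add, map_add]
  congr 2
  field_simp
  ring

/-! ### Analyticity of the Kronecker series and the quasi-periodic zeta function -/

-- The omitted index is the one with vanishing denominator at the base point `ζ₀` itself. All
-- remaining denominators stay at least `m / 2` near `ζ₀`, so the series is locally uniformly
-- dominated.
open Classical in
theorem differentiableAt_dampedSum_punctured {L : PeriodPair} (hA : 0 < areaConst L) {v Z : ℂ → ℂ}
    (hv : Differentiable ℂ v) (hZ : Differentiable ℂ Z) (ζ₀ : ℂ) :
    DifferentiableAt ℂ (fun ζ => ∑' γ : L.lattice, if Z ζ₀ + (γ : ℂ) = 0 then 0 else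
      dampedTerm L 0 (v ζ) (Z ζ) γ) ζ₀ := by
  obtain ⟨m, hm, hmin⟩ := exists_norm_add_ge L (Z ζ₀)
  set U : Set ℂ := {ζ | ‖v ζ‖ < ‖v ζ₀‖ + 1} ∩ {ζ | ‖Z ζ - Z ζ₀‖ < m / 2} with hU
  have hUo : IsOpen U := (isOpen_lt hv.continuous.norm continuous_const).inter
    (isOpen_lt (hZ.continuous.sub continuous_const).norm continuous_const)
  have hmem : ζ₀ ∈ U := by
    refine ⟨?_, ?_⟩
    · simp
    · simp [hm]
  have hge : ∀ γ : L.lattice, Z ζ₀ + (γ : ℂ) ≠ 0 → ∀ ζ ∈ U, m / 2 ≤ ‖Z ζ + (γ : ℂ)‖ := by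
    intro γ hγ ζ hζ
    have h1 := hmin γ hγ
    have h2 : ‖Z ζ - Z ζ₀‖ < m / 2 := hζ.2
    have h3 := norm_sub_le (Z ζ + (γ : ℂ)) (Z ζ - Z ζ₀)
    rw [show Z ζ + (γ : ℂ) - (Z ζ - Z ζ₀) = Z ζ₀ + γ by ring] at h3
    linarith
  refine (differentiableOn_tsum_of_summable_norm (U := U)
    ((summable_exp_neg_sq L (one_div_pos.2 hA) ((‖v ζ₀‖ + 1) / areaConst L)).mul_right (m / 2)⁻¹)
    (fun γ => ?_) hUo fun γ ζ hζ => ?_).differentiableAt (hUo.mem_nhds hmem)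
  · split_ifs with h
    · exact differentiableOn_const _
    · unfold dampedTerm
      refine DifferentiableOn.div (by fun_prop) (by fun_prop) fun ζ hζ => ?_
      exact norm_pos_iff.1 ((half_pos hm).trans_le (hge γ h ζ hζ))
  · split_ifs with h
    · rw [norm_zero]
      positivity
    · refine norm_dampedTerm_le hA (half_pos hm) ?_ fun _ => hge γ h ζ hζ
      rw [norm_zero, zero_add]
      exact (mem_ofPred.1 hζ.1).le

theorem differentiableAt_dampedSum {L : PeriodPair} (hA : 0 < areaConst L) {v Z : ℂ → ℂ}
    (hv : Differentiable ℂ v) (hZ : Differentiable ℂ Z) {ζ₀ : ℂ} (h : Z ζ₀ ∉ L.lattice) :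
    DifferentiableAt ℂ (fun ζ => dampedSum L 0 (v ζ) (Z ζ)) ζ₀ := by
  have h1 := differentiableAt_dampedSum_punctured hA hv hZ ζ₀
  simp only [add_coe_ne_zero h, if_false] at h1
  exact h1

open Classical in
/-- The sum of `dampedTerm L 0 v Z` over the nonzero elements of the lattice. -/
noncomputable def dampedSumPunctured (L : PeriodPair) (v Z : ℂ) : ℂ :=
  ∑' γ : L.lattice, if γ = 0 then 0 else dampedTerm L 0 v Z γ

/-- Isolates the polar term `γ = 0`. It also holds at `Z = 0`, where `1 / 0 = 0`, so that `dampedSum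
L 0 v 0` is automatically the punctured sum. -/
theorem dampedSum_eq_add {L : PeriodPair} (hA : 0 < areaConst L) (v Z : ℂ) :
    dampedSum L 0 v Z = 1 / Z + dampedSumPunctured L v Z := by
  classical
  rw [dampedSum, (summable_dampedTerm hA 0 v Z).tsum_eq_add_tsum_ite 0, dampedSumPunctured]
  simp [dampedTerm]

theorem differentiableAt_dampedSumPunctured {L : PeriodPair} (hA : 0 < areaConst L) {v Z : ℂ → ℂ}
    (hv : Differentiable ℂ v) (hZ : Differentiable ℂ Z) {ζ₀ : ℂ} (h : Z ζ₀ = 0) :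
    DifferentiableAt ℂ (fun ζ => dampedSumPunctured L (v ζ) (Z ζ)) ζ₀ := by
  classical
  have h1 := differentiableAt_dampedSum_punctured hA hv hZ ζ₀
  simp only [h, zero_add, ZeroMemClass.coe_eq_zero] at h1
  exact h1

/-- The logarithmic derivative of the theta function, as a damped lattice sum. -/
noncomputable def dampedZeta (L : PeriodPair) (z : ℂ) : ℂ := dampedSum L 0 z z + dampedSum L 0 z 0

theorem dampedZeta_eq {L : PeriodPair} (hA : 0 < areaConst L) (z : ℂ) :
    dampedZeta L z = 1 / z + (dampedSumPunctured L z z + dampedSumPunctured L z 0) := by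
  rw [dampedZeta, dampedSum_eq_add hA, dampedSum_eq_add hA z 0]
  simp [add_assoc]

theorem differentiableAt_dampedZeta {L : PeriodPair} (hA : 0 < areaConst L) {z : ℂ}
    (hz : z ∉ L.lattice) : DifferentiableAt ℂ (dampedZeta L) z := by
  have h1 := differentiableAt_dampedSum hA differentiable_id differentiable_id (ζ₀ := z) hz
  have h2 := differentiableAt_dampedSumPunctured (L := L) hA differentiable_id
    (differentiable_const (0 : ℂ)) (ζ₀ := z) rfl
  refine (h1.add h2).congr_of_eventuallyEq (.of_forall fun ζ => ?_)
  simp [dampedZeta, dampedSum_eq_add hA ζ 0]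

theorem eventually_notMem_lattice (L : PeriodPair) : ∀ᶠ w : ℂ in 𝓝[≠] 0, w ∉ L.lattice := by
  have h := L.compl_lattice_sdiff_singleton_mem_nhds 0
  filter_upwards [nhdsWithin_le_nhds h, self_mem_nhdsWithin] with w hw hw0 hmem
  exact hw ⟨hmem, hw0⟩

theorem differentiableAt_kroneckerSeries {L : PeriodPair} (hA : 0 < areaConst L) {Z W : ℂ}
    (hZ : Z ∉ L.lattice) (hW : W ∉ L.lattice) :
    DifferentiableAt ℂ (fun Z => kroneckerSeries L 0 Z W) Z := by
  simp only [kroneckerSeries_zero]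
  exact (differentiableAt_dampedSum hA (by fun_prop) differentiable_id hZ).add
    (differentiableAt_dampedSum hA (by fun_prop) (differentiable_const W) hW)

theorem exists_kroneckerSeries_sub {L : PeriodPair} (hA : 0 < areaConst L) {W : ℂ}
    (hW : W ∉ L.lattice) :
    ∃ f : ℂ → ℂ, DifferentiableAt ℂ f 0 ∧ ∀ Z, kroneckerSeries L 0 Z W = 1 / Z + f Z := by
  refine ⟨fun Z => dampedSumPunctured L (Z + W) Z + dampedSum L 0 (Z + W) W,
    (differentiableAt_dampedSumPunctured hA (by fun_prop) differentiable_id rfl).add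
      (differentiableAt_dampedSum hA (by fun_prop) (differentiable_const W) hW), fun Z => ?_⟩
  rw [kroneckerSeries_zero, dampedSum_eq_add hA _ Z]
  ring

theorem tendsto_kroneckerSeries_sub {L : PeriodPair} (hA : 0 < areaConst L) {Z : ℂ}
    (hZ : Z ∉ L.lattice) :
    Tendsto (fun W => kroneckerSeries L 0 Z W - 1 / W) (𝓝[≠] 0) (𝓝 (dampedZeta L Z)) := by
  have h1 : ContinuousAt (fun W => dampedSum L 0 (Z + W) Z) 0 :=
    (differentiableAt_dampedSum hA (v := fun W => Z + W) (Z := fun _ => Z) (by fun_prop)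
      (by fun_prop) hZ).continuousAt
  have h2 : ContinuousAt (fun W => dampedSumPunctured L (Z + W) W) 0 :=
    (differentiableAt_dampedSumPunctured hA (v := fun W => Z + W) (by fun_prop)
      differentiable_id rfl).continuousAt
  have h3 := (h1.add h2).tendsto.mono_left (nhdsWithin_le_nhds (s := {0}ᶜ))
  simp only [Pi.add_apply, add_zero] at h3
  have h4 : dampedSum L 0 Z Z + dampedSumPunctured L Z 0 = dampedZeta L Z := by
    rw [dampedZeta, dampedSum_eq_add hA Z 0]
    simp
  rw [h4] at h3
  refine h3.congr fun W => ?_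
  rw [kroneckerSeries_zero, dampedSum_eq_add hA _ W]
  simp only [Pi.add_apply]
  ring

/-- Compares constant terms at `W = 0` in the quasi-periodicity of the series: the multiplier `exp(W
conj l / A)` meets the pole `1 / W`, and its first-order coefficient is the additive period. -/
theorem dampedZeta_add_period {L : PeriodPair} (hA : 0 < areaConst L) {z : ℂ} (hz : z ∉ L.lattice)
    (l : L.lattice) : dampedZeta L (z + l) = dampedZeta L z + conj (l : ℂ) / areaConst L := by
  have hz' : z + l ∉ L.lattice := fun h => hz (by
    have := sub_mem h l.2
    rwa [add_sub_cancel_right] at this)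
  have h1 := tendsto_kroneckerSeries_sub hA hz'
  set c : ℂ := conj (l : ℂ) / areaConst L with hc
  have hd : HasDerivAt (fun w : ℂ => cexp (w * c)) c 0 := by
    have := ((hasDerivAt_id (0 : ℂ)).mul_const c).cexp
    simpa using this
  have h2 : Tendsto (fun w : ℂ => cexp (w * c)) (𝓝[≠] 0) (𝓝 1) := by
    have := hd.continuousAt.tendsto.mono_left (nhdsWithin_le_nhds (s := {0}ᶜ))
    simpa using this
  have h3 : Tendsto (fun w : ℂ => (cexp (w * c) - 1) / w) (𝓝[≠] 0) (𝓝 c) := by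
    have := hd.tendsto_slope
    simpa [slope_fun_def_field] using this
  have h4 := (h2.mul (tendsto_kroneckerSeries_sub hA hz)).add h3
  rw [one_mul] at h4
  refine tendsto_nhds_unique h1 (h4.congr' ?_)
  filter_upwards [eventually_notMem_lattice L] with w hw
  rw [kroneckerSeries_add_period hA hz hw, mul_div_assoc, ← hc]
  ring

theorem tsum_genClosed_zero {L : PeriodPair} (z w : ℂ) [DecidablePred fun γ : L.lattice =>
    (0 : ℂ) + (γ : ℂ) = 0] :
    (∑' γ : L.lattice, if (0 : ℂ) + (γ : ℂ) = 0 then 0 else genClosed L z w 0 0 γ) =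
      dampedSumPunctured L (z + w) z := by
  rw [dampedSumPunctured]
  refine tsum_congr fun γ => ?_
  by_cases h : γ = 0
  · simp [h]
  · rw [if_neg (by simpa using h), if_neg h, genClosed, dampedTerm, pairing]
    simp only [zero_add, map_zero, mul_zero, zero_mul, sub_zero, zero_div, exp_zero, one_mul, add_zero]
    rw [add_comm z (γ : ℂ)]
    congr 2
    ring

/-- The Laurent expansion of `dampedZeta` at the origin. -/
theorem exists_hasSum_dampedZeta {L : PeriodPair} (hA : 0 < areaConst L) :
    ∃ r : ℝ, 0 < r ∧ ∀ z : ℂ, ‖z‖ < r →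
      HasSum (fun k : ℕ => (-1) ^ k * ekNumber L 0 (k + 1) 0 0 * z ^ k) (dampedZeta L z - 1 / z) := by
  classical
  obtain ⟨m, hm, hmin⟩ := exists_norm_add_ge L 0
  refine ⟨m / 4, by positivity, fun z hz => ?_⟩
  -- At `w = 0` only the indices `a = 0` survive.
  have h := hasSum_ekNumber hA hm hmin hmin hz.le (w := 0) (by rw [norm_zero]; positivity)
  rw [tsum_genClosed_zero, tsum_genClosed_zero, add_zero, zero_add] at h
  have hp : pairing L 0 0 = 1 := by simp [pairing]
  rw [hp, one_mul] at h
  have hinj : Function.Injective fun k : ℕ => ((0 : ℕ), Nat.succPNat k) := fun a b hab =>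
    Nat.succPNat_injective (Prod.mk.inj hab).2
  have h2 := (hinj.hasSum_iff ?_).2 h
  · rw [dampedZeta_eq hA, add_sub_cancel_left]
    convert h2 using 1
    funext k
    simp only [Function.comp, Nat.succPNat_coe, Nat.succ_eq_add_one, zero_add, Nat.add_sub_cancel,
      Nat.factorial_zero, pow_zero, Nat.cast_one, div_one, mul_one]
  · rintro ⟨a, b⟩ hab
    have ha : a ≠ 0 := by
      rintro rfl
      exact hab ⟨b.natPred, by simp⟩
    simp [ha]

/-! ### The sigma function -/

/-- The elementary factor `(1 - x) exp(x + x² / 2)`. -/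
noncomputable def elemFactor (x : ℂ) : ℂ := (1 - x) * cexp (x + x ^ 2 / 2)

theorem hasDerivAt_elemFactor (x : ℂ) :
    HasDerivAt elemFactor (-x ^ 2 * cexp (x + x ^ 2 / 2)) x := by
  have h1 : HasDerivAt (fun x : ℂ => 1 - x) (-1) x := (hasDerivAt_id x).const_sub 1
  have h2 : HasDerivAt (fun x : ℂ => x + x ^ 2 / 2) (1 + x) x := by
    refine ((hasDerivAt_id x).add (((hasDerivAt_id x).pow 2).div_const 2)).congr_deriv ?_
    simp
  refine (h1.mul h2.cexp).congr_deriv ?_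
  ring

/-- The derivative of the elementary factor is divisible by `x²`, so the mean value inequality
yields a cubic bound, enough for convergence of the product over a rank-two lattice. -/
theorem norm_elemFactor_sub_one_le {R : ℝ} {x : ℂ} (hx : ‖x‖ ≤ R) :
    ‖elemFactor x - 1‖ ≤ Real.exp (R + R ^ 2 / 2) * ‖x‖ ^ 3 := by
  have h0 : elemFactor 0 = 1 := by simp [elemFactor]
  have hb : ∀ y ∈ Metric.closedBall (0 : ℂ) ‖x‖,
      ‖-y ^ 2 * cexp (y + y ^ 2 / 2)‖ ≤ Real.exp (R + R ^ 2 / 2) * ‖x‖ ^ 2 := by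
    intro y hy
    have hy' : ‖y‖ ≤ ‖x‖ := by simpa using hy
    rw [norm_mul, norm_neg, norm_pow, mul_comm]
    refine mul_le_mul ((norm_exp_le_exp_norm _).trans (Real.exp_le_exp.2 ?_))
      (pow_le_pow_left₀ (norm_nonneg _) hy' 2) (by positivity) (by positivity)
    refine (norm_add_le _ _).trans ?_
    rw [norm_div, norm_pow, norm_ofNat]
    have := hy'.trans hx
    gcongr
  have h := (convex_closedBall (0 : ℂ) ‖x‖).norm_image_sub_le_of_norm_hasDerivWithin_le
    (fun y _ => (hasDerivAt_elemFactor y).hasDerivWithinAt) hb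
    (Metric.mem_closedBall_self (norm_nonneg x)) (show x ∈ Metric.closedBall (0 : ℂ) ‖x‖ by simp)
  rw [h0, sub_zero] at h
  rw [pow_succ ‖x‖ 2, ← mul_assoc]
  exact h

/-- The entire function `σ(z) / z`. -/
noncomputable def sigmaProd (L : PeriodPair) (z : ℂ) : ℂ :=
  ∏' γ : {γ : L.lattice // γ ≠ 0}, elemFactor (z / (γ.1 : ℂ))

theorem sigma_eq (L : PeriodPair) (z : ℂ) : sigma L z = z * sigmaProd L z := by
  rw [sigma, sigmaProd]
  congr 2
  funext γ
  rw [elemFactor]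
  congr 3
  rw [div_pow]
  ring

theorem exists_norm_ge (L : PeriodPair) :
    ∃ m : ℝ, 0 < m ∧ ∀ γ : {γ : L.lattice // γ ≠ 0}, m ≤ ‖(γ.1 : ℂ)‖ := by
  obtain ⟨m, hm, h⟩ := exists_norm_add_ge L 0
  refine ⟨m, hm, fun γ => ?_⟩
  have := h γ.1 (by simpa using γ.2)
  rwa [zero_add] at this

theorem summable_inv_norm_cube (L : PeriodPair) :
    Summable fun γ : {γ : L.lattice // γ ≠ 0} => ‖(γ.1 : ℂ)‖⁻¹ ^ 3 := by
  have h3 : Summable fun γ : L.lattice => ‖γ‖⁻¹ ^ 3 :=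
    ZLattice.summable_norm_pow_inv L.lattice 3 (by simp)
  exact h3.comp_injective Subtype.val_injective

theorem exists_norm_elemFactor_sub_one_le (L : PeriodPair) (R : ℝ) :
    ∃ C : ℝ, ∀ z : ℂ, ‖z‖ ≤ R → ∀ γ : {γ : L.lattice // γ ≠ 0},
      ‖elemFactor (z / (γ.1 : ℂ)) - 1‖ ≤ C * ‖(γ.1 : ℂ)‖⁻¹ ^ 3 := by
  obtain ⟨m, hm, hmin⟩ := exists_norm_ge L
  refine ⟨Real.exp (R / m + (R / m) ^ 2 / 2) * R ^ 3, fun z hz γ => ?_⟩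
  have hR : 0 ≤ R := (norm_nonneg z).trans hz
  have hγ := hmin γ
  have h1 : ‖z / (γ.1 : ℂ)‖ ≤ R / m := by
    rw [norm_div]
    gcongr
  refine (norm_elemFactor_sub_one_le h1).trans ?_
  have h2 : ‖z / (γ.1 : ℂ)‖ ≤ R * ‖(γ.1 : ℂ)‖⁻¹ := by
    rw [norm_div, div_eq_mul_inv]
    gcongr
  rw [mul_assoc, ← mul_pow]
  gcongr

theorem multipliableLocallyUniformlyOn_sigmaProd (L : PeriodPair) (R : ℝ) :
    MultipliableLocallyUniformlyOn
      (fun (γ : {γ : L.lattice // γ ≠ 0}) (z : ℂ) => elemFactor (z / (γ.1 : ℂ)))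
      (Metric.ball (0 : ℂ) R) := by
  obtain ⟨C, hC⟩ := exists_norm_elemFactor_sub_one_le L R
  have h := Summable.multipliableLocallyUniformlyOn_one_add (K := Metric.ball (0 : ℂ) R)
    (f := fun (γ : {γ : L.lattice // γ ≠ 0}) (z : ℂ) => elemFactor (z / (γ.1 : ℂ)) - 1)
    Metric.isOpen_ball ((summable_inv_norm_cube L).mul_left C)
    (.of_forall fun γ z hz => hC z (by simpa using (Metric.mem_ball.1 hz).le) γ)
    (fun γ => by
      unfold elemFactor
      fun_prop)
  simpa using h

theorem differentiable_elemFactor : Differentiable ℂ elemFactor := fun x =>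
  (hasDerivAt_elemFactor x).differentiableAt

theorem differentiable_sigmaProd (L : PeriodPair) : Differentiable ℂ (sigmaProd L) := by
  intro z
  have h := (multipliableLocallyUniformlyOn_sigmaProd L (‖z‖ + 1)).hasProdLocallyUniformlyOn
  refine (h.differentiableOn (.of_forall fun s => ?_) Metric.isOpen_ball).differentiableAt
    (Metric.isOpen_ball.mem_nhds (by simp))
  exact DifferentiableOn.fun_finsetProd fun γ _ =>
    (differentiable_elemFactor.fun_comp (differentiable_id.div_const (γ.1 : ℂ))).differentiableOn

theorem sigmaProd_zero (L : PeriodPair) : sigmaProd L 0 = 1 := by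
  simp [sigmaProd, elemFactor]

theorem elemFactor_ne_zero {x : ℂ} (hx : x ≠ 1) : elemFactor x ≠ 0 :=
  mul_ne_zero (sub_ne_zero.2 hx.symm) (exp_ne_zero _)

theorem sigmaProd_ne_zero {L : PeriodPair} {z : ℂ} (hz : z = 0 ∨ z ∉ L.lattice) :
    sigmaProd L z ≠ 0 := by
  obtain ⟨C, hC⟩ := exists_norm_elemFactor_sub_one_le L ‖z‖
  have h := tprod_one_add_ne_zero_of_summable
    (f := fun γ : {γ : L.lattice // γ ≠ 0} => elemFactor (z / (γ.1 : ℂ)) - 1)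
    (fun γ => ?_) (Summable.of_nonneg_of_le (fun γ => norm_nonneg _) (fun γ => hC z le_rfl γ)
      ((summable_inv_norm_cube L).mul_left C))
  · simpa [sigmaProd] using h
  · rw [add_sub_cancel]
    refine elemFactor_ne_zero fun h1 => ?_
    have hγ : (γ.1 : ℂ) ≠ 0 := by simpa using γ.2
    rw [div_eq_one_iff_eq hγ] at h1
    rcases hz with rfl | hz
    · exact hγ h1.symm
    · exact hz (h1 ▸ γ.1.2)

theorem logDeriv_elemFactor_div {γ z : ℂ} (hγ : γ ≠ 0) (hz : z ≠ γ) :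
    logDeriv (fun z => elemFactor (z / γ)) z = -(z ^ 2 / (γ ^ 2 * (γ - z))) := by
  have h1 : z / γ ≠ 1 := by rwa [ne_eq, div_eq_one_iff_eq hγ]
  have h := (hasDerivAt_elemFactor (z / γ)).comp z ((hasDerivAt_id z).div_const γ)
  rw [logDeriv_apply]
  have h2 : deriv (fun z => elemFactor (z / γ)) z = _ := h.deriv
  rw [h2, elemFactor]
  have h3 : 1 - z / γ ≠ 0 := sub_ne_zero.2 h1.symm
  have h4 : γ - z ≠ 0 := sub_ne_zero.2 hz.symm
  have h5 := exp_ne_zero (z / γ + (z / γ) ^ 2 / 2)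
  generalize cexp (z / γ + (z / γ) ^ 2 / 2) = E at *
  have h6 : 1 - z / γ = (γ - z) / γ := by field_simp
  rw [h6]
  field_simp

/-- The logarithmic derivative of `σ(z) / z` near the origin. -/
theorem exists_hasSum_logDeriv_sigmaProd (L : PeriodPair) :
    ∃ r : ℝ, 0 < r ∧ ∀ z : ℂ, ‖z‖ < r →
      HasSum (fun k : ℕ => -(L.G (k + 3) * z ^ (k + 2))) (logDeriv (sigmaProd L) z) := by
  obtain ⟨m, hm, hmin⟩ := exists_norm_ge L
  refine ⟨m / 2, half_pos hm, fun z hz => ?_⟩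
  have hlt : ∀ γ : {γ : L.lattice // γ ≠ 0}, ‖z / (γ.1 : ℂ)‖ ≤ 1 / 2 := by
    intro γ
    have h1 := hmin γ
    rw [norm_div, div_le_div_iff₀ (hm.trans_le h1) two_pos]
    linarith
  have hγ0 : ∀ γ : {γ : L.lattice // γ ≠ 0}, (γ.1 : ℂ) ≠ 0 := fun γ => by simpa using γ.2
  have hne : ∀ γ : {γ : L.lattice // γ ≠ 0}, z ≠ (γ.1 : ℂ) := by
    intro γ h
    have h1 := hlt γ
    rw [h, div_self (hγ0 γ), norm_one] at h1
    norm_num at h1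
  have hfib : ∀ γ : {γ : L.lattice // γ ≠ 0}, HasSum
      (fun k : ℕ => -(((γ.1 : ℂ) ^ (k + 3))⁻¹ * z ^ (k + 2)))
      (logDeriv (fun z => elemFactor (z / (γ.1 : ℂ))) z) := by
    intro γ
    have h0 := hγ0 γ
    rw [logDeriv_elemFactor_div h0 (hne γ)]
    have h1 := (hasSum_geometric_of_norm_lt_one (ξ := z / (γ.1 : ℂ))
      ((hlt γ).trans_lt (by norm_num))).mul_left (-(z ^ 2 / (γ.1 : ℂ) ^ 3))
    have h2 : (γ.1 : ℂ) - z ≠ 0 := sub_ne_zero.2 (hne γ).symm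
    have h3 : 1 - z / (γ.1 : ℂ) = ((γ.1 : ℂ) - z) / γ.1 := by field_simp
    have h4 : -(z ^ 2 / (γ.1 : ℂ) ^ 3) * (1 - z / (γ.1 : ℂ))⁻¹ =
        -(z ^ 2 / ((γ.1 : ℂ) ^ 2 * (γ.1 - z))) := by
      rw [h3]
      field_simp
    rw [h4] at h1
    refine h1.congr_fun fun k => ?_
    rw [div_pow, pow_add, pow_add]
    field_simp
  have hs : Summable fun q : {γ : L.lattice // γ ≠ 0} × ℕ =>
      -(((q.1.1 : ℂ) ^ (q.2 + 3))⁻¹ * z ^ (q.2 + 2)) := by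
    have h1 := ((summable_inv_norm_cube L).mul_of_nonneg (summable_geometric_two)
      (fun γ => by positivity) (fun k => by positivity)).mul_left (‖z‖ ^ 2)
    refine Summable.of_norm_bounded h1 fun q => ?_
    have h2 := pow_le_pow_left₀ (norm_nonneg _) (hlt q.1) q.2
    have h3 : ‖-(((q.1.1 : ℂ) ^ (q.2 + 3))⁻¹ * z ^ (q.2 + 2))‖ =
        ‖z‖ ^ 2 * (‖(q.1.1 : ℂ)‖⁻¹ ^ 3 * ‖z / (q.1.1 : ℂ)‖ ^ q.2) := by
      rw [norm_neg, norm_mul, norm_inv, norm_pow, norm_pow, norm_div, div_pow, pow_add, pow_add,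
        inv_pow, mul_inv]
      ring
    rw [h3]
    gcongr
  have hfib2 : ∀ k : ℕ, HasSum (fun γ : {γ : L.lattice // γ ≠ 0} =>
      -(((γ.1 : ℂ) ^ (k + 3))⁻¹ * z ^ (k + 2))) (-(L.G (k + 3) * z ^ (k + 2))) := by
    intro k
    have h1 := hs.prod_symm.prod_factor k
    have h2 := h1.hasSum
    have h3 : ∑' γ : {γ : L.lattice // γ ≠ 0}, -(((γ.1 : ℂ) ^ (k + 3))⁻¹ * z ^ (k + 2)) =
        -(L.G (k + 3) * z ^ (k + 2)) := by
      rw [tsum_neg, tsum_mul_right, PeriodPair.G]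
      congr 2
      refine tsum_subtype_eq_of_support_subset (s := {γ : L.lattice | γ ≠ 0})
        (f := fun γ : L.lattice => ((γ : ℂ) ^ (k + 3))⁻¹) fun γ hγ h => hγ ?_
      simp [h]
    rw [← h3]
    exact h2
  have h1 := hs.hasSum.prod_fiberwise hfib
  have h2 := ((Equiv.prodComm _ _).hasSum_iff.2 hs.hasSum).prod_fiberwise hfib2
  have h3 : logDeriv (sigmaProd L) z =
      ∑' γ : {γ : L.lattice // γ ≠ 0}, logDeriv (fun z => elemFactor (z / (γ.1 : ℂ))) z :=
    logDeriv_tprod_eq_tsum Metric.isOpen_ball (s := Metric.ball (0 : ℂ) (m / 2)) (by simpa using hz)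
      (fun γ => elemFactor_ne_zero (by rw [ne_eq, div_eq_one_iff_eq (hγ0 γ)]; exact hne γ))
      (fun γ => (differentiable_elemFactor.comp (differentiable_id.div_const _)).differentiableOn)
      h1.summable (multipliableLocallyUniformlyOn_sigmaProd L _)
      (sigmaProd_ne_zero (by
        by_contra! h
        have := hlt ⟨⟨z, h.2⟩, by simpa using h.1⟩
        rw [div_self h.1, norm_one] at this
        norm_num at this))
  rw [h3, h1.tsum_eq]
  exact h2

theorem thetaSum_zero_of_odd (L : PeriodPair) {n : ℕ} (hn : Odd n) (t : ℝ) :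
    thetaSum L n t 0 0 0 = 0 := by
  rw [← CharZero.eq_neg_self_iff, thetaSum, ← tsum_neg, ← (Equiv.neg _).tsum_eq]
  refine tsum_congr fun γ => ?_
  simp [thetaTerm, pairing, hn.neg_pow]

theorem ekNumber_zero_one {L : PeriodPair} (hA : 0 < areaConst L) : ekNumber L 0 1 0 0 = 0 := by
  have h := ekNumber_eq hA 0 0 0 0
  have h1 : upperMellin L (0 + 0 + 1) 0 0 0 = 0 := by
    simp [upperMellin, thetaSum_zero_of_odd L odd_one]
  rw [h, h1]
  simp

/-- The point `s = b` lies in the half-plane of absolute convergence exactly when `b / 2 + 1 < b`,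
that is `b ≥ 3`; there `conj γ ^ b / |γ| ^ (2b) = γ ^ (-b)`. -/
theorem ekNumber_zero_eq_G {L : PeriodPair} (hA : 0 < areaConst L) {b : ℕ} (hb : 3 ≤ b) :
    ekNumber L 0 b 0 0 = L.G b := by
  have hb' : (3 : ℝ) ≤ b := by exact_mod_cast hb
  have h := (isLerchContinuation_lerchK hA (n := 0 + b) (by omega) 0 0).1.eq_series (b : ℂ)
    (by rw [natCast_re, zero_add]; linarith)
  rw [ekNumber, h, lerchSeries, PeriodPair.G]
  have h1 : ∀ γ : {γ : L.lattice // (γ : ℂ) ≠ -0},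
      conj (0 + (γ.1 : ℂ)) ^ (0 + b) / (‖0 + (γ.1 : ℂ)‖ : ℂ) ^ (2 * (b : ℂ)) *
        pairing L (γ.1 : ℂ) 0 = ((γ.1 : ℂ) ^ b)⁻¹ := by
    intro γ
    have hγ : (γ.1 : ℂ) ≠ 0 := by simpa using γ.2
    have hc : conj (γ.1 : ℂ) ≠ 0 := by simpa using hγ
    have h2 : (2 * (b : ℂ)) = ((2 * b : ℕ) : ℂ) := by push_cast; ring
    have h3 : pairing L (γ.1 : ℂ) 0 = 1 := by simp [pairing]
    rw [h3, mul_one, zero_add, zero_add, h2, cpow_natCast, pow_mul, ← conj_mul', mul_pow]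
    field_simp
  rw [tsum_congr h1]
  refine tsum_subtype_eq_of_support_subset (s := {γ : L.lattice | (γ : ℂ) ≠ -0})
    (f := fun γ : L.lattice => ((γ : ℂ) ^ b)⁻¹) fun γ hγ h => hγ ?_
  have h0 : (γ : ℂ) = 0 := by simpa using h
  simp [h0, show b ≠ 0 by omega]

/-! ### The theta function and its logarithmic derivative -/

theorem theta_eq (L : PeriodPair) (z : ℂ) :
    theta L z = cexp (-(ekNumber L 0 2 0 0 / 2) * z ^ 2) * (z * sigmaProd L z) := by
  rw [theta, sigma_eq]

theorem differentiable_theta (L : PeriodPair) : Differentiable ℂ (theta L) := by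
  have h := differentiable_sigmaProd L
  have h1 : theta L = fun z => cexp (-(ekNumber L 0 2 0 0 / 2) * z ^ 2) * (z * sigmaProd L z) :=
    funext (theta_eq L)
  rw [h1]
  fun_prop

theorem theta_ne_zero {L : PeriodPair} {z : ℂ} (hz : z ∉ L.lattice) : theta L z ≠ 0 := by
  rw [theta_eq]
  refine mul_ne_zero (exp_ne_zero _) (mul_ne_zero ?_ (sigmaProd_ne_zero (.inr hz)))
  rintro rfl
  exact hz (zero_mem _)

/-- Laurent coefficients at the origin agree: the constant term is `0`, the linear one is
`-e*_{0,2}(0,0)`, supplied by the Gaussian factor of `θ`, and the higher ones are those of the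
logarithmic derivative of `σ(z) / z`. -/
theorem eventually_deriv_theta {L : PeriodPair} (hA : 0 < areaConst L) :
    ∀ᶠ z : ℂ in 𝓝[≠] 0, deriv (theta L) z = dampedZeta L z * theta L z := by
  obtain ⟨r₁, hr₁, h₁⟩ := exists_hasSum_dampedZeta hA
  obtain ⟨r₂, hr₂, h₂⟩ := exists_hasSum_logDeriv_sigmaProd L
  have hb : Metric.ball (0 : ℂ) (min r₁ r₂) ∈ 𝓝[≠] (0 : ℂ) :=
    nhdsWithin_le_nhds (Metric.ball_mem_nhds 0 (lt_min hr₁ hr₂))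
  filter_upwards [hb, eventually_notMem_lattice L, self_mem_nhdsWithin] with z hz hzL hz0
  have hz0 : z ≠ 0 := hz0
  rw [mem_ball_zero_iff, lt_min_iff] at hz
  have h1 := h₁ z hz.1
  have h2 := h₂ z hz.2
  set e := ekNumber L 0 2 0 0 with he
  have h3 := (hasSum_nat_add_iff' 2).2 h1
  have h4 : ∀ k : ℕ, (-1) ^ (k + 2) * ekNumber L 0 (k + 2 + 1) 0 0 * z ^ (k + 2) =
      -(L.G (k + 3) * z ^ (k + 2)) := by
    intro k
    rw [ekNumber_zero_eq_G hA (by omega)]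
    -- The alternating sign is harmless: for even `k` the Eisenstein sum of odd index `k + 3`
    -- vanishes, and for odd `k` the sign is `-1`.
    rcases Nat.even_or_odd k with hk | hk
    · rw [show k + 2 + 1 = k + 3 by omega, L.G_eq_zero_of_odd (k + 3) (by
        exact hk.add_odd (by decide))]
      simp
    · rw [(hk.add_even (by decide : Even 2)).neg_one_pow]
      ring
  simp only [h4] at h3
  have h5 := h3.unique h2
  simp only [Finset.sum_range_succ, Finset.sum_range_zero, zero_add, ekNumber_zero_one hA,
    one_add_one_eq_two, ← he] at h5
  have hS : sigmaProd L z ≠ 0 := sigmaProd_ne_zero (.inr hzL)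
  have h6 : dampedZeta L z = 1 / z - e * z + deriv (sigmaProd L) z / sigmaProd L z := by
    rw [logDeriv_apply] at h5
    linear_combination h5
  have h7 := (((hasDerivAt_pow 2 z).const_mul (-(e / 2))).cexp).mul
    ((hasDerivAt_id z).mul (differentiable_sigmaProd L z).hasDerivAt)
  have h8 : deriv (theta L) z = _ := (h7.congr_of_eventuallyEq (.of_forall (theta_eq L))).deriv
  rw [h8, h6, theta_eq, ← he]
  simp only [id, Pi.mul_apply]
  push_cast
  field_simp
  ring

theorem countable_lattice (L : PeriodPair) : (L.lattice : Set ℂ).Countable :=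
  Set.countable_coe_iff.1 (countable_of_Lindelof_of_discrete (X := L.lattice))

theorem isPreconnected_compl_lattice (L : PeriodPair) :
    IsPreconnected (L.lattice : Set ℂ)ᶜ :=
  ((countable_lattice L).isConnected_compl_of_one_lt_rank (by simp)).isPreconnected

theorem isOpen_compl_lattice (L : PeriodPair) : IsOpen (L.lattice : Set ℂ)ᶜ :=
  L.isClosed_lattice.isOpen_compl

theorem dense_compl_lattice (L : PeriodPair) : Dense (L.lattice : Set ℂ)ᶜ :=
  (countable_lattice L).dense_compl ℝ

theorem deriv_theta {L : PeriodPair} (hA : 0 < areaConst L) {z : ℂ} (hz : z ∉ L.lattice) :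
    deriv (theta L) z = dampedZeta L z * theta L z := by
  have ho := isOpen_compl_lattice L
  have hd : DifferentiableOn ℂ (dampedZeta L) (L.lattice : Set ℂ)ᶜ := fun z hz =>
    (differentiableAt_dampedZeta hA hz).differentiableWithinAt
  have h1 : AnalyticOnNhd ℂ (deriv (theta L)) (L.lattice : Set ℂ)ᶜ :=
    ((differentiable_theta L).differentiableOn.analyticOnNhd isOpen_univ).deriv.mono
      (subset_univ _)
  have h2 : AnalyticOnNhd ℂ (fun z => dampedZeta L z * theta L z) (L.lattice : Set ℂ)ᶜ :=
    (hd.mul (differentiable_theta L).differentiableOn).analyticOnNhd ho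
  -- The identity theorem needs a base point off the lattice with equality on a full neighbourhood;
  -- the origin itself does not qualify.
  have h3 : ∀ᶠ p in 𝓝[≠] (0 : ℂ), p ∉ L.lattice ∧
      ∀ᶠ z in 𝓝 p, deriv (theta L) z = dampedZeta L z * theta L z := by
    filter_upwards [eventually_notMem_lattice L,
      eventually_eventually_nhdsWithin.2 (eventually_deriv_theta hA), self_mem_nhdsWithin]
      with p hp h h0
    refine ⟨hp, ?_⟩
    rwa [IsOpen.nhdsWithin_eq isOpen_compl_singleton h0] at h
  obtain ⟨p, hp, hpe⟩ := h3.exists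
  exact h1.eqOn_of_preconnected_of_eventuallyEq h2 (isPreconnected_compl_lattice L) hp hpe hz

theorem add_coe_notMem {L : PeriodPair} {z : ℂ} (hz : z ∉ L.lattice) (l : L.lattice) :
    z + l ∉ L.lattice := fun h => hz (by
  have := sub_mem h l.2
  rwa [add_sub_cancel_right] at this)

/-- The additive periods of `θ'/θ` make the quotient of the two sides locally constant on the
connected complement of the lattice; density then extends the identity to the lattice points. -/
theorem exists_theta_add_period {L : PeriodPair} (hA : 0 < areaConst L) (l : L.lattice) :
    ∃ C : ℂ, ∀ z, theta L (z + l) = C * cexp (z * conj (l : ℂ) / areaConst L) * theta L z := by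
  have hθ := differentiable_theta L
  set c : ℂ := conj (l : ℂ) / areaConst L with hc
  set q : ℂ → ℂ := fun z => theta L (z + l) / (cexp (z * c) * theta L z) with hq
  have hd : ∀ z ∉ L.lattice, HasDerivAt q 0 z := by
    intro z hz
    have hz' := add_coe_notMem hz l
    have h1 : HasDerivAt (fun z => theta L (z + l)) (deriv (theta L) (z + l)) z :=
      (hθ (z + l)).hasDerivAt.comp_add_const z (l : ℂ)
    have h2 := (((hasDerivAt_id z).mul_const c).cexp).mul (hθ z).hasDerivAt
    have h0 : cexp (z * c) * theta L z ≠ 0 := mul_ne_zero (exp_ne_zero _) (theta_ne_zero hz)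
    refine (h1.div h2 h0).congr_deriv ?_
    simp only [id, Pi.mul_apply]
    rw [deriv_theta hA hz, deriv_theta hA hz', dampedZeta_add_period hA hz, div_eq_zero_iff]
    left
    rw [← hc]
    ring
  obtain ⟨C, hC⟩ := (isOpen_compl_lattice L).exists_is_const_of_deriv_eq_zero
    (isPreconnected_compl_lattice L)
    (fun z hz => (hd z hz).differentiableAt.differentiableWithinAt) (fun z hz => (hd z hz).deriv)
  refine ⟨C, fun z => ?_⟩
  have hcont := hθ.continuous
  have h1 : EqOn (fun z => theta L (z + l))
      (fun z => C * cexp (z * conj (l : ℂ) / areaConst L) * theta L z) (L.lattice : Set ℂ)ᶜ := by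
    intro z hz
    have h2 : q z = C := hC z hz
    have h0 : cexp (z * c) * theta L z ≠ 0 := mul_ne_zero (exp_ne_zero _) (theta_ne_zero hz)
    rw [hq] at h2
    simp only at h2 ⊢
    rw [div_eq_iff h0] at h2
    rw [h2, hc, mul_div_assoc]
    ring
  exact congr_fun (Continuous.ext_on (dense_compl_lattice L) (by fun_prop) (by fun_prop) h1) z

/-- The constant `C` and the factor depending on `z` cancel between `θ(z + w)` and `θ(z)`, leaving a
multiplier that depends on `w` only. -/
theorem kroneckerTheta_add_period {L : PeriodPair} (hA : 0 < areaConst L) {z : ℂ}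
    (hz : z ∉ L.lattice) (w : ℂ) (l : L.lattice) :
    kroneckerTheta L (z + l) w =
      cexp (w * conj (l : ℂ) / areaConst L) * kroneckerTheta L z w := by
  obtain ⟨C, hC⟩ := exists_theta_add_period hA l
  have hCz := theta_ne_zero (add_coe_notMem hz l)
  rw [hC z] at hCz
  have hC0 : C ≠ 0 := fun h => by simp [h] at hCz
  have hz0 := theta_ne_zero hz
  rw [kroneckerTheta, kroneckerTheta, add_right_comm, hC, hC, add_mul, add_div, exp_add]
  have h1 := exp_ne_zero (z * conj (l : ℂ) / areaConst L)
  by_cases hw : theta L w = 0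
  · simp [hw]
  field_simp

/-! ### Uniqueness of quasi-periodic functions -/

theorem exists_real_coords (L : PeriodPair) (w : ℂ) : ∃ x y : ℝ, w = x * L.ω₁ + y * L.ω₂ := by
  refine ⟨L.basis.repr w 0, L.basis.repr w 1, ?_⟩
  have h := L.basis.sum_repr w
  rw [Fin.sum_univ_two, L.basis_zero, L.basis_one, real_smul, real_smul] at h
  exact h.symm

theorem mem_lattice_of_pairing_eq_one {L : PeriodPair} (hA : 0 < areaConst L) {w : ℂ}
    (h : ∀ l : L.lattice, pairing L w l = 1) : w ∈ L.lattice := by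
  have hAc : (areaConst L : ℂ) ≠ 0 := by exact_mod_cast hA.ne'
  have hpi : (Real.pi : ℂ) ≠ 0 := by exact_mod_cast Real.pi_ne_zero
  have h2pi : (2 * Real.pi * I : ℂ) ≠ 0 := two_pi_I_ne_zero
  obtain ⟨x, y, rfl⟩ := exists_real_coords L w
  have hp := im_period L
  have h1 := h ⟨_, L.ω₁_mem_lattice⟩
  have h2 := h ⟨_, L.ω₂_mem_lattice⟩
  have e1 : ((x * L.ω₁ + y * L.ω₂) * conj L.ω₁ - L.ω₁ * conj (x * L.ω₁ + y * L.ω₂)) /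
      (areaConst L : ℂ) = y * (2 * Real.pi * I) := by
    rw [div_eq_iff hAc, map_add, map_mul, map_mul, conj_ofReal, conj_ofReal]
    linear_combination (y : ℂ) * hp
  have e2 : ((x * L.ω₁ + y * L.ω₂) * conj L.ω₂ - L.ω₂ * conj (x * L.ω₁ + y * L.ω₂)) /
      (areaConst L : ℂ) = -x * (2 * Real.pi * I) := by
    rw [div_eq_iff hAc, map_add, map_mul, map_mul, conj_ofReal, conj_ofReal]
    linear_combination -(x : ℂ) * hp
  rw [pairing, e1, exp_eq_one_iff] at h1
  rw [pairing, e2, exp_eq_one_iff] at h2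
  obtain ⟨n, hn⟩ := h1
  obtain ⟨m, hm⟩ := h2
  have hn := mul_right_cancel₀ h2pi hn
  have hm := mul_right_cancel₀ h2pi hm
  refine PeriodPair.mem_lattice.2 ⟨-m, n, ?_⟩
  have hx : (x : ℂ) = -m := by linear_combination -hm
  rw [hn, hx]
  push_cast
  ring

theorem exists_norm_sub_lattice_le (L : PeriodPair) :
    ∃ R : ℝ, ∀ z : ℂ, ∃ l : L.lattice, ‖z + l‖ ≤ R := by
  refine ⟨‖L.ω₁‖ + ‖L.ω₂‖, fun z => ?_⟩
  obtain ⟨x, y, rfl⟩ := exists_real_coords L z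
  refine ⟨⟨_, PeriodPair.mem_lattice.2 ⟨-⌊x⌋, -⌊y⌋, rfl⟩⟩, ?_⟩
  have e : (x * L.ω₁ + y * L.ω₂ + (((-⌊x⌋ : ℤ) : ℂ) * L.ω₁ + ((-⌊y⌋ : ℤ) : ℂ) * L.ω₂) : ℂ) =
      ((Int.fract x : ℝ) : ℂ) * L.ω₁ + ((Int.fract y : ℝ) : ℂ) * L.ω₂ := by
    rw [Int.fract, Int.fract]
    push_cast
    ring
  rw [e]
  refine (norm_add_le _ _).trans ?_
  rw [norm_mul, norm_mul, norm_real, norm_real, Real.norm_of_nonneg (Int.fract_nonneg x),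
    Real.norm_of_nonneg (Int.fract_nonneg y)]
  exact add_le_add (mul_le_of_le_one_left (norm_nonneg _) (Int.fract_lt_one x).le)
    (mul_le_of_le_one_left (norm_nonneg _) (Int.fract_lt_one y).le)

/-- Multiplication by `exp(-z conj w / A)` turns the multiplier into the unitary character `⟨w, l⟩`.
The resulting entire function is bounded, hence constant; a nonzero constant would force the
character to be trivial, so `w ∈ Γ`. -/
theorem eq_zero_of_entire_quasiPeriodic {L : PeriodPair} (hA : 0 < areaConst L) {w : ℂ}
    (hw : w ∉ L.lattice) {D : ℂ → ℂ} (hD : Differentiable ℂ D)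
    (hper : ∀ z, ∀ l : L.lattice, D (z + l) = cexp (w * conj (l : ℂ) / areaConst L) * D z) (z : ℂ) :
    D z = 0 := by
  set f : ℂ → ℂ := fun z => D z * cexp (-(z * conj w) / areaConst L) with hf
  have hfd : Differentiable ℂ f := by fun_prop
  have hfp : ∀ z, ∀ l : L.lattice, f (z + l) = pairing L w l * f z := by
    intro z l
    have e : cexp (w * conj (l : ℂ) / areaConst L) * cexp (-((z + l) * conj w) / areaConst L) =
        pairing L w l * cexp (-(z * conj w) / areaConst L) := by
      rw [pairing, ← exp_add, ← exp_add]
      congr 1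
      ring
    simp only [hf]
    rw [hper]
    linear_combination D z * e
  obtain ⟨R, hR⟩ := exists_norm_sub_lattice_le L
  obtain ⟨M, hM⟩ := (isCompact_closedBall (0 : ℂ) R).exists_bound_of_continuousOn
    hfd.continuous.continuousOn
  have hbd : Bornology.IsBounded (range f) := by
    refine isBounded_iff_forall_norm_le.2 ⟨M, ?_⟩
    rintro _ ⟨z, rfl⟩
    obtain ⟨l, hl⟩ := hR z
    have h := hM (z + l) (by simpa using hl)
    rwa [hfp, norm_mul, norm_pairing, one_mul] at h
  have hconst := hfd.apply_eq_apply_of_bounded hbd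
  by_contra hz
  refine hw (mem_lattice_of_pairing_eq_one hA fun l => ?_)
  have h := hfp z l
  rw [hconst (z + l) z] at h
  have hz' : f z ≠ 0 := mul_ne_zero hz (exp_ne_zero _)
  exact (mul_right_cancel₀ hz' (by rw [one_mul]; exact h)).symm

/-- A quasi-periodic function with multipliers `exp(w * conj l / A)`, holomorphic off the lattice and
with a removable singularity at the origin, vanishes unless `w` is a lattice point. -/
theorem eq_zero_of_quasiPeriodic {L : PeriodPair} (hA : 0 < areaConst L) {w : ℂ}
    (hw : w ∉ L.lattice) {D g : ℂ → ℂ} (hD : ∀ z ∉ L.lattice, DifferentiableAt ℂ D z)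
    (hper : ∀ z ∉ L.lattice, ∀ l : L.lattice,
      D (z + l) = cexp (w * conj (l : ℂ) / areaConst L) * D z)
    (hg : DifferentiableAt ℂ g 0) (hDg : D =ᶠ[𝓝[≠] 0] g) {z : ℂ} (hz : z ∉ L.lattice) :
    D z = 0 := by
  classical
  -- Values at the lattice points are prescribed by quasi-periodicity from the removable value at
  -- `0`, so that differentiability at `0` propagates to every lattice point.
  set E : ℂ → ℂ := fun z =>
    if z ∈ L.lattice then cexp (w * conj z / areaConst L) * g 0 else D z with hE
  have hEper : ∀ z, ∀ l : L.lattice,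
      E (z + l) = cexp (w * conj (l : ℂ) / areaConst L) * E z := by
    intro z l
    by_cases hz : z ∈ L.lattice
    · simp only [hE]
      rw [if_pos hz, if_pos (add_mem hz l.2), ← mul_assoc, ← exp_add]
      congr 2
      rw [map_add]
      ring
    · simp only [hE]
      rw [if_neg hz, if_neg (add_coe_notMem hz l), hper z hz]
  have hE0 : DifferentiableAt ℂ E 0 := by
    refine hg.congr_of_eventuallyEq ?_
    refine eventuallyEq_nhds_of_eventuallyEq_nhdsNE ?_ (by simp [hE])
    filter_upwards [hDg, eventually_notMem_lattice L] with z h1 h2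
    simp only [hE]
    rw [if_neg h2, h1]
  have hEd : Differentiable ℂ E := by
    intro z
    by_cases hz : z ∈ L.lattice
    · have h1 : E = fun u => cexp (w * conj z / areaConst L) * E (u - z) := by
        funext u
        have := hEper (u - z) ⟨z, hz⟩
        rwa [sub_add_cancel] at this
      rw [h1]
      refine DifferentiableAt.const_mul ?_ _
      have h2 : DifferentiableAt ℂ E (z - z) := by rwa [sub_self]
      exact DifferentiableAt.comp (g := E) z h2 (differentiableAt_id.sub_const z)
    · refine (hD z hz).congr_of_eventuallyEq ?_
      filter_upwards [(isOpen_compl_lattice L).mem_nhds hz] with u hu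
      exact if_neg hu
  have h := eq_zero_of_entire_quasiPeriodic hA hw hEd hEper z
  simp only [hE] at h
  rwa [if_neg hz] at h

theorem kroneckerTheta_eq_kroneckerSeries {L : PeriodPair} (hA : 0 < areaConst L) {z w : ℂ}
    (hz : z ∉ L.lattice) (hw : w ∉ L.lattice) :
    kroneckerTheta L z w = kroneckerSeries L 0 z w := by
  have hθ := differentiable_theta L
  have hθw := theta_ne_zero hw
  obtain ⟨f, hf, hfe⟩ := exists_kroneckerSeries_sub hA hw
  set e := ekNumber L 0 2 0 0 with he
  -- `h` is `θ(z) θ(w) / z`, so `Θ(z, w) = k(z) / z` with `k 0 = 1`; the regular part at the pole is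
  -- the difference quotient `dslope k 0`.
  set h : ℂ → ℂ := fun z => cexp (-(e / 2) * z ^ 2) * sigmaProd L z * theta L w with hh
  set k : ℂ → ℂ := fun z => theta L (z + w) / h z with hk
  have hσ := differentiable_sigmaProd L
  have hhd : Differentiable ℂ h := by fun_prop
  have hh0 : h 0 = theta L w := by simp [hh, sigmaProd_zero]
  have hk0 : k 0 = 1 := by simp only [hk]; rw [hh0, zero_add, div_self hθw]
  set U : Set ℂ := {z | h z ≠ 0} with hU
  have hUo : IsOpen U := isOpen_ne_fun hhd.continuous continuous_const
  have hU0 : (0 : ℂ) ∈ U := by simpa [hU, hh0] using hθw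
  have hkd : DifferentiableOn ℂ k U := fun z hz =>
    (((hθ.fun_comp (differentiable_id.add_const w)) z).div (hhd z) hz).differentiableWithinAt
  have hds : DifferentiableAt ℂ (dslope k 0) 0 :=
    ((differentiableOn_dslope (hUo.mem_nhds hU0)).2 hkd).differentiableAt (hUo.mem_nhds hU0)
  refine sub_eq_zero.1 (eq_zero_of_quasiPeriodic hA hw
    (D := fun z => kroneckerTheta L z w - kroneckerSeries L 0 z w)
    (g := fun z => dslope k 0 z - f z) (fun z hz => ?_) (fun z hz l => ?_) (hds.sub hf) ?_ hz)
  · refine DifferentiableAt.sub ?_ (differentiableAt_kroneckerSeries hA hz hw)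
    exact ((hθ.fun_comp (differentiable_id.add_const w)) z).div ((hθ z).mul_const _)
      (mul_ne_zero (theta_ne_zero hz) hθw)
  · rw [kroneckerTheta_add_period hA hz, kroneckerSeries_add_period hA hz hw, mul_sub]
  · filter_upwards [self_mem_nhdsWithin] with z hz0
    have hz0 : z ≠ 0 := hz0
    rw [dslope_of_ne k hz0, slope_def_field, hk0, hfe, kroneckerTheta, theta_eq L z, sub_zero,
      sub_div, sub_sub]
    congr 1
    simp only [hk, hh]
    rw [div_div]
    congr 1
    ring

/-! ### Polar terms and the final Laurent expansion -/

theorem pairing_mul_pairing_comm (L : PeriodPair) (z w : ℂ) : pairing L z w * pairing L w z = 1 := by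
  rw [pairing, pairing, ← exp_add, ← exp_zero]
  congr 1
  ring

-- The omitted index exists only for `z₀ ∈ Γ`, namely `γ = -z₀`. There the exponential is `1` and
-- the denominator is `z`, which gives the polar term.
open Classical in
theorem tsum_genClosed_ne {L : PeriodPair} (hA : 0 < areaConst L) (z w z₀ w₀ : ℂ) :
    (∑' γ : L.lattice, if z₀ + (γ : ℂ) = 0 then 0 else genClosed L z w z₀ w₀ γ) =
      ∑' γ : L.lattice, genClosed L z w z₀ w₀ γ - pairing L w₀ z₀ * latticeDelta L z₀ / z := by
  by_cases hz₀ : z₀ ∈ L.lattice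
  · set γ₀ : L.lattice := ⟨-z₀, neg_mem hz₀⟩
    have h0 : genClosed L z w z₀ w₀ γ₀ = pairing L w₀ z₀ * latticeDelta L z₀ / z := by
      have hp : pairing L (-z₀) w₀ = pairing L w₀ z₀ := by
        simp only [pairing, map_neg]
        congr 1
        ring
      simp [genClosed, latticeDelta, hz₀, γ₀, hp]
    rw [(summable_genClosed hA z w z₀ w₀).tsum_eq_add_tsum_ite γ₀, h0, add_sub_cancel_left]
    refine tsum_congr fun γ => ?_
    have h1 : z₀ + (γ : ℂ) = 0 ↔ γ = γ₀ := by
      rw [Subtype.ext_iff, add_comm, add_eq_zero_iff_eq_neg]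
    by_cases h : γ = γ₀
    · rw [if_pos (h1.2 h), if_pos h]
    · rw [if_neg (mt h1.1 h), if_neg h]
  · simp [latticeDelta, hz₀, add_coe_ne_zero hz₀]

theorem add_notMem_lattice {L : PeriodPair} {m : ℝ} {z z₀ : ℂ}
    (hmin : ∀ γ : L.lattice, z₀ + (γ : ℂ) ≠ 0 → m ≤ ‖z₀ + (γ : ℂ)‖) (hz : ‖z‖ < m)
    (h0 : z₀ ∈ L.lattice → z ≠ 0) : z + z₀ ∉ L.lattice := by
  intro h
  have h1 : z₀ + ((⟨-(z + z₀), neg_mem h⟩ : L.lattice) : ℂ) = -z := by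
    simp
  have h2 := hmin ⟨-(z + z₀), neg_mem h⟩
  rw [h1, norm_neg] at h2
  by_cases hz0 : z = 0
  · subst hz0
    rw [zero_add] at h
    exact h0 h rfl
  · exact absurd (h2 (neg_ne_zero.2 hz0)) (not_le.2 hz)

/-- The Laurent expansion of the translated Kronecker theta function at the origin. -/
theorem hasSum_kroneckerThetaTranslate {L : PeriodPair} (hA : 0 < areaConst L) (z₀ w₀ : ℂ) :
    ∃ r : ℝ, 0 < r ∧ ∀ z w : ℂ, ‖z‖ < r → ‖w‖ < r →
      (z₀ ∈ L.lattice → z ≠ 0) → (w₀ ∈ L.lattice → w ≠ 0) →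
      (z + z₀ ∉ L.lattice ∧ w + w₀ ∉ L.lattice) ∧
      HasSum (fun p : ℕ × ℕ+ =>
          (-1 : ℂ) ^ (p.1 + (p.2 : ℕ) - 1) *
            (ekNumber L p.1 p.2 z₀ w₀ / ((p.1 ! : ℂ) * (areaConst L : ℂ) ^ p.1)) *
            z ^ ((p.2 : ℕ) - 1) * w ^ p.1)
        (kroneckerThetaTranslate L z₀ w₀ z w - pairing L w₀ z₀ * latticeDelta L z₀ / z -
          latticeDelta L w₀ / w) := by
  classical
  obtain ⟨m₁, hm₁, hz₀⟩ := exists_norm_add_ge L z₀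
  obtain ⟨m₂, hm₂, hw₀⟩ := exists_norm_add_ge L w₀
  have hm : 0 < min m₁ m₂ := lt_min hm₁ hm₂
  have hz₀' : ∀ γ : L.lattice, z₀ + (γ : ℂ) ≠ 0 → min m₁ m₂ ≤ ‖z₀ + (γ : ℂ)‖ :=
    fun γ h => (min_le_left _ _).trans (hz₀ γ h)
  have hw₀' : ∀ γ : L.lattice, w₀ + (γ : ℂ) ≠ 0 → min m₁ m₂ ≤ ‖w₀ + (γ : ℂ)‖ :=
    fun γ h => (min_le_right _ _).trans (hw₀ γ h)
  refine ⟨min m₁ m₂ / 4, by positivity, fun z w hz hw h1 h2 => ?_⟩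
  have hzL := add_notMem_lattice hz₀' (hz.trans (by linarith)) h1
  have hwL := add_notMem_lattice hw₀' (hw.trans (by linarith)) h2
  refine ⟨⟨hzL, hwL⟩, ?_⟩
  have h := hasSum_ekNumber hA hm hz₀' hw₀' hz.le hw.le
  convert h using 1
  rw [tsum_genClosed_ne hA, tsum_genClosed_ne hA, kroneckerThetaTranslate,
    kroneckerTheta_eq_kroneckerSeries hA hzL hwL, ← tsum_genClosed_add hA hzL hwL]
  -- The second half is multiplied by `⟨w₀, z₀⟩`, while its polar term carries `⟨z₀, w₀⟩`; the two
  -- cancel, so `δ(w₀) / w` appears without a factor.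
  linear_combination (latticeDelta L w₀ / w) * pairing_mul_pairing_comm L z₀ w₀

end EisensteinKronecker

/-- The Laurent expansion of `Θ_{z₀,w₀}` at the origin; the pair `p = (p.1, p.2)` stands for
the indices `a = p.1 ≥ 0` and `b = p.2 > 0`. -/
theorem mainTheorem1 (L : PeriodPair) (hL : 0 < (L.ω₂ / L.ω₁).im) (z₀ w₀ : ℂ) :
    (∀ n : ℕ, 1 ≤ n →
      EisensteinKronecker.IsLerchContinuation L n z₀ w₀ (EisensteinKronecker.lerchK L n z₀ w₀) ∧
      Differentiable ℂ (EisensteinKronecker.lerchK L n z₀ w₀)) ∧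
    ∃ r : ℝ, 0 < r ∧ ∀ z w : ℂ, ‖z‖ < r → ‖w‖ < r →
      (z₀ ∈ L.lattice → z ≠ 0) → (w₀ ∈ L.lattice → w ≠ 0) →
      (z + z₀ ∉ L.lattice ∧ w + w₀ ∉ L.lattice) ∧
      HasSum (fun p : ℕ × ℕ+ =>
          (-1 : ℂ) ^ (p.1 + (p.2 : ℕ) - 1) *
            (EisensteinKronecker.ekNumber L p.1 p.2 z₀ w₀ /
              ((p.1 ! : ℂ) * (EisensteinKronecker.areaConst L : ℂ) ^ p.1)) *
            z ^ ((p.2 : ℕ) - 1) * w ^ p.1)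
        (EisensteinKronecker.kroneckerThetaTranslate L z₀ w₀ z w -
          EisensteinKronecker.pairing L w₀ z₀ * EisensteinKronecker.latticeDelta L z₀ / z -
          EisensteinKronecker.latticeDelta L w₀ / w) := by
  have hA := EisensteinKronecker.areaConst_pos hL
  exact ⟨fun n hn => EisensteinKronecker.isLerchContinuation_lerchK hA hn z₀ w₀,
    EisensteinKronecker.hasSum_kroneckerThetaTranslate hA z₀ w₀⟩
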